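/- Let $d\ge 3$ and let $\varphi$ be a Littlewood–Paley function on $\mathbb{R}^d$, i.e. $\varphi$ is smooth, real-valued, radial, supported in an annulus $\{r\le|\xi|\le R\}$ with $0<r<R<\infty$, and $\sum_{j\in\mathbb{Z}}\varphi(2^{-j}\xi)=1$ for all $\xi\neq0$. Let $\dot\Delta_j$ be the Fourier multiplier with symbol $\varphi(2^{-j}\cdot)$ and put $$\|f\|_{\dot B^{-1}_{\infty,\infty}}=\sup_{j\in\mathbb{Z}}2^{-j}\|\dot\Delta_jf\|_{L^\infty}\in[0,\infty].$$ For $u_0\in L^\infty_\sigma(\mathbb{R}^d)$ (bounded vector fields with $\operatorname{div}u_0=0$ in the sense of distributions) and $T\in(0,\infty]$, a strong solution of the Navier–Stokes equations on $(0,T)$ with initial data $u_0$ is a function $u\in C((0,T);L^\infty(\mathbb{R}^d;\mathbb{R}^d))$, bounded in $L^\infty$ on $(0,S]$ for every $S<T$, such that $$u(t)=e^{t\Delta}u_0-\int_0^te^{(t-s)\Delta}\mathbb{P}\nabla\cdot(u\otimes u)(s)\,ds\qquad\text{for all }t\in(0,T),$$ where $\mathbb{P}$ is the Leray projection. Let $T^*=T^*(u_0)\in(0,\infty]$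 be the maximal time of existence, i.e. the supremum of all $T$ for which such a solution exists, and let $u$ be the unique strong solution on $(0,T^*)$ with initial data $u_0$. There is a constant $\varepsilon_*>0$, depending only on $d$ and $\varphi$ (in particular not on $u_0$ or $u$), such that for every $u_0\in L^\infty_\sigma(\mathbb{R}^d)$: if $$\sup_{0<t<T^*}\|u(\cdot,t)\|_{\dot B^{-1}_{\infty,\infty}}<\varepsilon_*,$$ then $T^*=+\infty$. -/

import Mathlib

open MeasureTheory Set Filter Topology
open scoped ENNReal FourierTransform ContDiff

noncomputable section

namespace NavierStokes

/-- The space `ℝ^d` with its Euclidean norm. -/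
abbrev Space (d : ℕ) : Type := EuclideanSpace ℝ (Fin d)

/-- The Banach space `L^∞(ℝ^d; ℝ^d)` of essentially bounded vector fields. -/
abbrev LInfty (d : ℕ) : Type := Lp (Space d) ∞ (volume : Measure (Space d))

/-- The partial derivative `∂_i f (x)`. -/
def pderiv {d : ℕ} (i : Fin d) (f : Space d → ℝ) (x : Space d) : ℝ :=
  lineDeriv ℝ f x (EuclideanSpace.single i 1)

/-- `v ∈ L^∞_σ`: the field `v` is divergence free in the sense of distributions,
`∫ v · ∇ψ = 0` for every test function `ψ ∈ C_c^∞(ℝ^d)`. -/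
def IsDivFree {d : ℕ} (v : LInfty d) : Prop :=
  ∀ ψ : Space d → ℝ, ContDiff ℝ ∞ ψ → HasCompactSupport ψ →
    ∫ x, ∑ i, v x i * pderiv i ψ x = 0

/-! ### Heat semigroup and Oseen kernel -/

/-- The heat kernel `Γ_t(x) = (4πt)^{-d/2} exp(-|x|²/(4t))`, for `t > 0`. -/
def heatKernel {d : ℕ} (t : ℝ) (x : Space d) : ℝ :=
  (4 * Real.pi * t) ^ (-(d : ℝ) / 2) * Real.exp (-‖x‖ ^ 2 / (4 * t))

/-- The heat semigroup `e^{tΔ} f = Γ_t * f`, for `t > 0`. -/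
def heatSemigroup {d : ℕ} (t : ℝ) (f : Space d → Space d) (x : Space d) : Space d :=
  ∫ y, heatKernel t (x - y) • f y

/-- The convolution kernel of `e^{tΔ} P_{ij} ∂_k`, for `t > 0`, where
`P_{ij} = δ_{ij} + ∂_i ∂_j (-Δ)^{-1}` is the Leray projection.  Since
`(-Δ)^{-1} e^{tΔ} = ∫_t^∞ e^{sΔ} ds`, it is `δ_{ij} ∂_k Γ_t + ∫_t^∞ ∂_i ∂_j ∂_k Γ_s ds`;
its symbol is `(δ_{ij} - ξ_i ξ_j / |ξ|²) (i ξ_k) e^{-t|ξ|²}`. -/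
def oseenKernel {d : ℕ} (t : ℝ) (i j k : Fin d) (x : Space d) : ℝ :=
  (if i = j then pderiv k (heatKernel t) x else 0) +
    ∫ s in Ioi t, pderiv i (pderiv j (pderiv k (heatKernel s))) x

/-- The field `e^{tΔ} P ∇·(v ⊗ v)`, for `t > 0`; its `i`-th component is
`∑_{j,k} e^{tΔ} P_{ij} ∂_k (v_j v_k)`. -/
def oseenDiv {d : ℕ} (t : ℝ) (v : Space d → Space d) (x : Space d) : Space d :=
  WithLp.toLp 2 fun i => ∑ j, ∑ k, ∫ y, oseenKernel t i j k (x - y) * (v y j * v y k)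

/-! ### Strong solutions and the maximal time of existence -/

/-- The open time interval `(0, T)`, where `T ∈ [0, ∞]`. -/
def timeInterval (T : ℝ≥0∞) : Set ℝ := {t | 0 < t ∧ ENNReal.ofReal t < T}

/-- `u` is the strong (mild, `L^∞`) solution of the Navier-Stokes equations
`∂_t u - Δu + P ∇·(u ⊗ u) = 0` on `ℝ^d × (0, T)` with initial data `u₀`:
`u ∈ C((0, T); L^∞)`, `u` is bounded in `L^∞` on `(0, S]` for every `S < T`, and
`u(t) = e^{tΔ} u₀ - ∫_0^t e^{(t-s)Δ} P ∇·(u ⊗ u)(s) ds` for all `t ∈ (0, T)`. -/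
structure IsStrongSolution {d : ℕ} (u₀ : LInfty d) (T : ℝ≥0∞) (u : ℝ → LInfty d) : Prop where
  continuousOn : ContinuousOn u (timeInterval T)
  bounded : ∀ S ∈ timeInterval T, ∃ M : ℝ, ∀ t ∈ Ioc 0 S, ‖u t‖ ≤ M
  duhamel : ∀ t ∈ timeInterval T, ∀ᵐ x : Space d,
    u t x = heatSemigroup t u₀ x - ∫ s in (0 : ℝ)..t, oseenDiv (t - s) (u s) x

/-- The maximal time of existence `T^*` of the strong solution with initial data `u₀`. -/
def maximalTime {d : ℕ} (u₀ : LInfty d) : ℝ≥0∞ :=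
  sSup {T | ∃ u : ℝ → LInfty d, IsStrongSolution u₀ T u}

/-! ### The homogeneous Besov norm -/

/-- A (homogeneous) Littlewood-Paley partition of unity: a smooth radial function `φ`
supported in an annulus with `∑_{j ∈ ℤ} φ(2^{-j} ξ) = 1` for all `ξ ≠ 0`. -/
structure IsLittlewoodPaley {d : ℕ} (φ : Space d → ℝ) : Prop where
  contDiff : ContDiff ℝ ∞ φ
  radial : ∀ ξ η, ‖ξ‖ = ‖η‖ → φ ξ = φ η
  annulus : ∃ r R : ℝ, 0 < r ∧ ∀ ξ, φ ξ ≠ 0 → r ≤ ‖ξ‖ ∧ ‖ξ‖ ≤ R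
  partition : ∀ ξ, ξ ≠ 0 → HasSum (fun j : ℤ => φ ((2 : ℝ) ^ (-j) • ξ)) 1

/-- The convolution kernel of the dyadic block, the inverse Fourier transform of
`φ(2^{-j} ·)`.  It is real since `φ` is real and radial.  Mathlib's normalization is
`∫ e^{2πi⟨x, ξ⟩} φ(2^{-j} ξ) dξ`; the normalization with `e^{i⟨x, ξ⟩}` is recovered by
using `φ(2π ·)`, which is again a Littlewood-Paley partition of unity, for `φ`. -/
def dyadicKernel {d : ℕ} (φ : Space d → ℝ) (j : ℤ) (x : Space d) : ℝ :=
  (𝓕⁻ (fun ξ : Space d => (φ ((2 : ℝ) ^ (-j) • ξ) : ℂ)) x).re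

/-- The homogeneous dyadic block `Δ̇_j f`. -/
def dyadicBlock {d : ℕ} (φ : Space d → ℝ) (j : ℤ) (f : Space d → Space d) (x : Space d) :
    Space d :=
  ∫ y, dyadicKernel φ j (x - y) • f y

/-- The norm `‖f‖_{Ḃ^{-1}_{∞,∞}} = sup_{j ∈ ℤ} 2^{-j} ‖Δ̇_j f‖_{L^∞}`, with values in `[0, ∞]`. -/
def besovNorm {d : ℕ} (φ : Space d → ℝ) (f : Space d → Space d) : ℝ≥0∞ :=
  ⨆ j : ℤ, ENNReal.ofReal ((2 : ℝ) ^ (-j)) * eLpNorm (dyadicBlock φ j f) ∞ volume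

/-- Littlewood-Paley partitions of unity exist. -/
theorem exists_isLittlewoodPaley (d : ℕ) : ∃ φ : Space d → ℝ, IsLittlewoodPaley φ := by
  -- `θ = 1` on `(-∞, 1]` and `θ = 0` on `[2, ∞)`
  let θ : ℝ → ℝ := fun s => 1 - Real.smoothTransition (s - 1)
  have θ1 : ∀ s, s ≤ 1 → θ s = 1 := fun s hs => by
    simp [θ, Real.smoothTransition.zero_of_nonpos (show s - 1 ≤ 0 by linarith)]
  have θ0 : ∀ s, 2 ≤ s → θ s = 0 := fun s hs => by
    simp [θ, Real.smoothTransition.one_of_one_le (show 1 ≤ s - 1 by linarith)]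
  have hθ : ContDiff ℝ ∞ θ :=
    contDiff_const.sub (Real.smoothTransition.contDiff.comp (contDiff_id.sub contDiff_const))
  refine ⟨fun ξ => θ (‖ξ‖ ^ 2) - θ (4 * ‖ξ‖ ^ 2), ?_, ?_, ⟨1 / 2, 2, by norm_num, ?_⟩, ?_⟩
  · exact (hθ.comp (contDiff_norm_sq ℝ)).sub
      (hθ.comp (contDiff_const.mul (contDiff_norm_sq ℝ)))
  · intro ξ η h
    simp only [h]
  · intro ξ h
    have h0 := norm_nonneg ξ
    constructor
    · by_contra! hc
      exact h (by rw [θ1 _ (by nlinarith), θ1 _ (by nlinarith), sub_self])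
    · by_contra! hc
      exact h (by rw [θ0 _ (by nlinarith), θ0 _ (by nlinarith), sub_self])
  · intro ξ hξ
    have hpos : 0 < ‖ξ‖ := norm_pos_iff.2 hξ
    -- `g j = θ(|2^{-j} ξ|²)` telescopes from `0` to `1`
    let g : ℤ → ℝ := fun j => θ (((2 : ℝ) ^ (-j) * ‖ξ‖) ^ 2)
    have hg : ∀ j : ℤ, θ (‖(2 : ℝ) ^ (-j) • ξ‖ ^ 2) - θ (4 * ‖(2 : ℝ) ^ (-j) • ξ‖ ^ 2)
        = g j - g (j - 1) := by
      intro j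
      have h2 : (2 : ℝ) ^ (-(j - 1)) = 2 * 2 ^ (-j) := by
        rw [show -(j - 1) = 1 + -j by ring, zpow_add₀ two_ne_zero, zpow_one]
      have hn : ‖(2 : ℝ) ^ (-j) • ξ‖ = 2 ^ (-j) * ‖ξ‖ := by
        rw [norm_smul, Real.norm_of_nonneg (by positivity)]
      simp only [g, hn, h2]
      congr 2
      ring
    simp only [hg]
    obtain ⟨N, hN⟩ := pow_unbounded_of_one_lt (‖ξ‖ + 2 / ‖ξ‖) (one_lt_two : (1 : ℝ) < 2)
    have hN1 : ‖ξ‖ ≤ 2 ^ N := by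
      have : 0 < 2 / ‖ξ‖ := by positivity
      linarith
    have hN2 : 2 ≤ 2 ^ N * ‖ξ‖ := by
      have : 2 / ‖ξ‖ ≤ 2 ^ N := by linarith
      rwa [div_le_iff₀ hpos] at this
    have hhi : ∀ j : ℤ, (N : ℤ) ≤ j → g j = 1 := by
      intro j hj
      apply θ1
      have h3 : (2 : ℝ) ^ (-j) ≤ 2 ^ (-(N : ℤ)) := zpow_le_zpow_right₀ one_le_two (by omega)
      have h4 : (2 : ℝ) ^ (-j) * ‖ξ‖ ≤ 2 ^ (-(N : ℤ)) * 2 ^ N := by gcongr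
      rw [zpow_neg 2 (N : ℤ), zpow_natCast, inv_mul_cancel₀ (by positivity)] at h4
      have h5 : 0 ≤ (2 : ℝ) ^ (-j) * ‖ξ‖ := by positivity
      nlinarith
    have hlo : ∀ j : ℤ, j ≤ -(N : ℤ) → g j = 0 := by
      intro j hj
      apply θ0
      have h3 : (2 : ℝ) ^ (N : ℤ) ≤ 2 ^ (-j) := zpow_le_zpow_right₀ one_le_two (by omega)
      rw [zpow_natCast] at h3
      have h4 : (2 : ℝ) ^ N * ‖ξ‖ ≤ 2 ^ (-j) * ‖ξ‖ := by gcongr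
      nlinarith
    have hsum : ∀ n : ℕ, ∑ j ∈ Finset.Ioc (-(N : ℤ)) (-(N : ℤ) + n), (g j - g (j - 1))
        = g (-(N : ℤ) + n) - g (-(N : ℤ)) := by
      intro n
      induction n with
      | zero => simp
      | succ n ih =>
        have : Finset.Ioc (-(N : ℤ)) (-(N : ℤ) + (n + 1 : ℕ))
            = insert (-(N : ℤ) + (n + 1 : ℕ)) (Finset.Ioc (-(N : ℤ)) (-(N : ℤ) + n)) := by
          ext a
          simp only [Finset.mem_Ioc, Finset.mem_insert]
          omega
        rw [this, Finset.sum_insert (by simp), ih,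
          show -(N : ℤ) + (n + 1 : ℕ) - 1 = -(N : ℤ) + n by push_cast; ring]
        ring
    have key := hsum (2 * N)
    rw [hhi _ (by push_cast; omega), hlo _ le_rfl, sub_zero] at key
    rw [← key]
    apply hasSum_sum_of_ne_finset_zero
    intro j hj
    rw [Finset.mem_Ioc, not_and_or, not_lt, not_le] at hj
    rcases hj with hj | hj
    · rw [hlo _ hj, hlo _ (by omega), sub_self]
    · rw [hhi _ (by push_cast at hj; omega), hhi _ (by push_cast at hj; omega), sub_self]

end NavierStokes

end

/-! The theorem combines an a priori bound with a continuation principle. If the Besov norm stays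
below a fixed threshold, then `‖u t‖ ≤ C ‖u₀‖` as long as the solution lives
(`IsLittlewoodPaley.exists_apriori_bound`). A solution bounded up to a finite time can be prolonged
beyond it (`not_bounded_of_maximalTime_ne_top`), so the maximal time cannot be finite.

For the a priori bound let `M` be the supremum of `‖u s‖` over `(0, S]`, and write `u = H - W` with
`H` the heat flow of `u₀` and `W` the Duhamel term. Let `S_j` be the low-pass filter at frequency
`2^j`, so that the dyadic block is `S_j - S_{j-1}`. At a cut-off `2^N` the solution has three
contributions. (a) High frequencies of `W`. By scaling, second differences of the Oseen kernel at
time `r` have `L¹` norm at most a constant times `min (r^{-1/2}) (|h|² r^{-3/2})`, whose integral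
over `(0, ∞)` is of order `|h|`. Hence `W` has second differences of size `M²|h|`, uniformly in time
(`exists_norm_secDiffAt_duhamel_le`), and `W - S_N W` is of size `M² 2^{-N}`
(`norm_sub_convOp_dyadicDil_le`). (b) Intermediate frequencies of `u`. Summing dyadic blocks as a
geometric series gives at most `2^{N+1} ε`, whatever the lower cut-off (`ae_norm_conv_sub_conv_le`).
(c) The lowest frequencies. Those of `W` tend to zero because the Oseen kernel is odd and so has
mean zero (`tendsto_convOp_duhamel`); all contributions of `H` are bounded by a constant times
`‖u₀‖`. Taking `2^N` comparable to `M` makes (a) and (b) at most `M/4` each, provided `ε` is small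
in terms of absolute constants only. The resulting `M/2` is absorbed on the left.

For continuation, a contraction argument is run on the whole interval `(0, t₁ + δ)` among paths that
agree with `u` up to `t₁`. Two such paths differ only during the last `δ` units of time, so their
Duhamel terms differ by a factor `√δ`, and `δ` depends only on bounds (`exists_continuation`). The
equation is always posed from time zero, so no restart of the flow is needed. -/

noncomputable section

namespace NavierStokes

open scoped BoundedContinuousFunction SchwartzMap LineDeriv

variable {d : ℕ}

/-! ### Convolution `L¹ * L^∞` with values in bounded continuous functions -/

/-- The space `L¹(ℝ^d)` of convolution kernels. -/
abbrev LOne (d : ℕ) : Type := Lp ℝ 1 (volume : Measure (Space d))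

/-- The map `y ↦ x - y`. -/
def reflectAt (x : Space d) : C(Space d, Space d) := ⟨fun y => x - y, by fun_prop⟩

lemma measurePreserving_reflectAt (x : Space d) :
    MeasurePreserving (reflectAt x) (volume : Measure (Space d)) volume :=
  Measure.measurePreserving_sub_left volume x

/-- The kernel `k(x - ·)`. -/
def reflectLp (k : LOne d) (x : Space d) : LOne d :=
  Lp.compMeasurePreserving (reflectAt x) (measurePreserving_reflectAt x) k

lemma continuous_reflectAt : Continuous (reflectAt : Space d → C(Space d, Space d)) := by
  apply ContinuousMap.continuous_of_continuous_uncurry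
  exact continuous_fst.sub continuous_snd

/-- Translation is strongly continuous on `L¹`; this puts all regularity on the kernel and makes `k
* f` continuous for merely bounded `f`. -/
lemma continuous_reflectLp (k : LOne d) : Continuous (reflectLp k) :=
  continuous_const.compMeasurePreservingLp continuous_reflectAt _ ENNReal.one_ne_top

lemma norm_reflectLp (k : LOne d) (x : Space d) : ‖reflectLp k x‖ = ‖k‖ :=
  Lp.norm_compMeasurePreserving _ _

/-- The pairing `∫ k • f` between `L¹` and `L^∞`. -/
def pairing : LOne d →L[ℝ] LInfty d →L[ℝ] Space d :=
  (ContinuousLinearMap.lsmul ℝ ℝ : ℝ →L[ℝ] Space d →L[ℝ] Space d).lpPairing volume 1 ∞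

lemma norm_pairing_le (k : LOne d) (f : LInfty d) : ‖pairing k f‖ ≤ ‖k‖ * ‖f‖ := by
  have hB : ‖(ContinuousLinearMap.lsmul ℝ ℝ : ℝ →L[ℝ] Space d →L[ℝ] Space d)‖ ≤ 1 :=
    ContinuousLinearMap.opNorm_lsmul_le
  have h := ContinuousLinearMap.norm_holder_apply_apply_le (r := 1)
    (ContinuousLinearMap.lsmul ℝ ℝ : ℝ →L[ℝ] Space d →L[ℝ] Space d) k f
  have e : pairing k f = L1.integral ((ContinuousLinearMap.lsmul ℝ ℝ :
      ℝ →L[ℝ] Space d →L[ℝ] Space d).holder 1 k f) := by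
    rw [L1.integral_eq]; rfl
  rw [e]
  refine (L1.norm_integral_le _).trans (h.trans ?_)
  have : 0 ≤ ‖k‖ * ‖f‖ := by positivity
  nlinarith

lemma pairing_eq_integral (k : LOne d) (f : LInfty d) : pairing k f = ∫ y, k y • f y := by
  simp only [pairing, ContinuousLinearMap.lpPairing_eq_integral, ContinuousLinearMap.lsmul_apply]

/-- The convolution `k * f` of `k ∈ L¹` and `f ∈ L^∞`, a bounded continuous function. -/
def convFun (k : LOne d) (f : LInfty d) : Space d →ᵇ Space d :=
  BoundedContinuousFunction.ofNormedAddCommGroup (fun x => pairing (reflectLp k x) f)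
    ((pairing.flip f).continuous.comp (continuous_reflectLp k)) (‖k‖ * ‖f‖)
    fun x => (norm_pairing_le _ _).trans_eq (by rw [norm_reflectLp])

lemma convFun_apply (k : LOne d) (f : LInfty d) (x : Space d) :
    convFun k f x = pairing (reflectLp k x) f := rfl

lemma norm_convFun_le (k : LOne d) (f : LInfty d) : ‖convFun k f‖ ≤ ‖k‖ * ‖f‖ :=
  BoundedContinuousFunction.norm_ofNormedAddCommGroup_le _ (by positivity) _

/-- The convolution `(k, f) ↦ k * f` as a bounded bilinear map. -/
def conv : LOne d →L[ℝ] LInfty d →L[ℝ] (Space d →ᵇ Space d) :=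
  LinearMap.mkContinuous₂
    (LinearMap.mk₂ ℝ convFun
      (fun k k' f => by
        ext1 x
        have : reflectLp (k + k') x = reflectLp k x + reflectLp k' x := map_add _ _ _
        simp [convFun_apply, this])
      (fun c k f => by
        ext1 x
        have : reflectLp (c • k) x = c • reflectLp k x :=
          map_smul (Lp.compMeasurePreservingₗ ℝ (reflectAt x) (measurePreserving_reflectAt x)) c k
        simp [convFun_apply, this])
      (fun k f f' => by ext1 x; simp [convFun_apply])
      (fun c k f => by ext1 x; simp [convFun_apply]))
    1 (fun k f => by
      rw [one_mul]
      exact norm_convFun_le k f)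

lemma conv_apply (k : LOne d) (f : LInfty d) (x : Space d) :
    conv k f x = pairing (reflectLp k x) f := rfl

lemma norm_conv_le (k : LOne d) (f : LInfty d) : ‖conv k f‖ ≤ ‖k‖ * ‖f‖ := norm_convFun_le k f

lemma conv_toL1_apply {k : Space d → ℝ} (hk : Integrable k) (f : LInfty d) (x : Space d) :
    conv (hk.toL1 k) f x = ∫ y, k (x - y) • f y := by
  rw [conv_apply, pairing_eq_integral]
  refine integral_congr_ae ?_
  have h1 : reflectLp (hk.toL1 k) x =ᵐ[volume] (hk.toL1 k) ∘ reflectAt x :=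
    Lp.coeFn_compMeasurePreserving _ _
  have h2 := (measurePreserving_reflectAt x).quasiMeasurePreserving.ae_eq_comp hk.coeFn_toL1
  filter_upwards [h1, h2] with y hy1 hy2
  rw [hy1, hy2]
  rfl

lemma norm_toL1_eq {k : Space d → ℝ} (hk : Integrable k) : ‖hk.toL1 k‖ = ∫ x, ‖k x‖ :=
  L1.norm_of_fun_eq_integral_norm hk

/-! ### Bounded continuous functions as elements of `L^∞` -/

lemma memLp_top_bcf (g : Space d →ᵇ Space d) : MemLp g (⊤ : ℝ≥0∞) (volume : Measure (Space d)) :=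
  memLp_top_of_bound g.continuous.aestronglyMeasurable ‖g‖ (ae_of_all _ g.norm_coe_le_norm)

lemma norm_LInfty_le {f : LInfty d} {C : ℝ} (hC : 0 ≤ C) (h : ∀ᵐ x, ‖f x‖ ≤ C) : ‖f‖ ≤ C := by
  rw [Lp.norm_def]
  refine ENNReal.toReal_le_of_le_ofReal hC ?_
  rw [eLpNorm_exponent_top]
  exact eLpNormEssSup_le_of_ae_bound h

lemma ae_norm_le (f : LInfty d) : ∀ᵐ x, ‖f x‖ ≤ ‖f‖ := by
  have h := ae_le_eLpNormEssSup (f := f) (μ := volume)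
  filter_upwards [h] with x hx
  rw [Lp.norm_def, eLpNorm_exponent_top]
  have hfin : eLpNormEssSup f (volume : Measure (Space d)) ≠ ⊤ := by
    rw [← eLpNorm_exponent_top]; exact Lp.eLpNorm_ne_top f
  rw [← toReal_enorm]
  exact ENNReal.toReal_mono hfin hx

/-- The class in `L^∞` of a bounded continuous function. -/
def toLInfty : (Space d →ᵇ Space d) →L[ℝ] LInfty d :=
  LinearMap.mkContinuous
    { toFun := fun g => (memLp_top_bcf g).toLp g
      map_add' := fun _ _ => rfl
      map_smul' := fun _ _ => rfl } 1 (fun g => by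
        rw [one_mul]
        refine norm_LInfty_le (norm_nonneg g) ?_
        filter_upwards [(memLp_top_bcf g).coeFn_toLp] with x hx
        exact hx ▸ g.norm_coe_le_norm x)

lemma coeFn_toLInfty (g : Space d →ᵇ Space d) : toLInfty g =ᵐ[volume] g :=
  (memLp_top_bcf g).coeFn_toLp

lemma norm_toLInfty_le (g : Space d →ᵇ Space d) : ‖toLInfty g‖ ≤ ‖g‖ := by
  refine norm_LInfty_le (norm_nonneg g) ?_
  filter_upwards [coeFn_toLInfty g] with x hx
  exact hx ▸ g.norm_coe_le_norm x

/-- Evaluation at a point, as a continuous linear map. -/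
def evalAt (x : Space d) : (Space d →ᵇ Space d) →L[ℝ] Space d :=
  BoundedContinuousFunction.evalCLM ℝ x

lemma evalAt_apply (x : Space d) (g : Space d →ᵇ Space d) : evalAt x g = g x := rfl

/-! ### Products of components -/

/-- The bilinear map `(v, w) ↦ v_j w_k e_i`. -/
def componentMulAux (i j k : Fin d) : Space d →L[ℝ] Space d →L[ℝ] Space d :=
  LinearMap.mkContinuous₂
    (LinearMap.mk₂ ℝ (fun v w => (v j * w k) • EuclideanSpace.single i (1 : ℝ))
      (fun a b c => by simp [add_mul, add_smul])
      (fun a b c => by simp [mul_smul, mul_assoc])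
      (fun a b c => by simp [mul_add, add_smul])
      (fun a b c => by simp [smul_smul, mul_left_comm]))
    1 (fun v w => by
      have h1 : ‖v j‖ ≤ ‖v‖ := PiLp.norm_apply_le v j
      have h2 : ‖w k‖ ≤ ‖w‖ := PiLp.norm_apply_le w k
      simp only [LinearMap.mk₂_apply, norm_smul, norm_mul, PiLp.norm_single, norm_one,
        mul_one, one_mul]
      gcongr)

/-- The bilinear map `(v, w) ↦ v_j w_k e_i` on `L^∞`. -/
def componentMul (i j k : Fin d) : LInfty d →L[ℝ] LInfty d →L[ℝ] LInfty d :=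
  (componentMulAux i j k).holderL volume ∞ ∞ ∞

lemma coeFn_componentMul (i j k : Fin d) (v w : LInfty d) :
    componentMul i j k v w =ᵐ[volume] fun x => (v x j * w x k) • EuclideanSpace.single i (1 : ℝ) :=
  ContinuousLinearMap.coeFn_holder _ _ _

lemma norm_componentMul_le (i j k : Fin d) (v w : LInfty d) :
    ‖componentMul i j k v w‖ ≤ ‖v‖ * ‖w‖ := by
  have h := ContinuousLinearMap.norm_holder_apply_apply_le (r := ∞) (componentMulAux i j k) v w
  have hB : ‖componentMulAux i j k‖ ≤ 1 := LinearMap.mkContinuous₂_norm_le _ zero_le_one _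
  refine h.trans ?_
  have : 0 ≤ ‖v‖ * ‖w‖ := by positivity
  nlinarith

section

open scoped Nat

/-! ### The Gaussian as a Schwartz function -/

lemma norm_iteratedFDeriv_real_exp (i : ℕ) (x : ℝ) :
    ‖iteratedFDeriv ℝ i Real.exp x‖ = Real.exp x := by
  rw [norm_iteratedFDeriv_eq_norm_iteratedDeriv, iteratedDeriv_eq_iterate, Real.iter_deriv_exp,
    Real.norm_of_nonneg (Real.exp_pos x).le]

/-- The exponential series bounds the power by `p! e^{1+r}`, and `1 + r - r²/4 = 2 - (r-2)²/4`. -/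
lemma pow_mul_exp_neg_sq_le (p : ℕ) {r : ℝ} (hr : 0 ≤ r) :
    (1 + r) ^ p * Real.exp (-(r ^ 2 / 4)) ≤ p ! * Real.exp 2 := by
  have h1 : (1 + r) ^ p ≤ p ! * Real.exp (1 + r) := by
    have := Real.pow_div_factorial_le_exp (1 + r) (by linarith) p
    rwa [div_le_iff₀ (by positivity), mul_comm] at this
  calc (1 + r) ^ p * Real.exp (-(r ^ 2 / 4))
      ≤ (p ! * Real.exp (1 + r)) * Real.exp (-(r ^ 2 / 4)) := by gcongr
    _ = p ! * Real.exp (1 + r - r ^ 2 / 4) := by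
        rw [mul_assoc, ← Real.exp_add]; congr 2
    _ ≤ p ! * Real.exp 2 := by
        gcongr
        nlinarith [sq_nonneg (r - 2)]

/-- The function `exp(-|x|²/4)` as a Schwartz function. -/
def expNegSq : 𝓢(Space d, ℝ) where
  toFun x := Real.exp (-(‖x‖ ^ 2 / 4))
  smooth' := Real.contDiff_exp.comp (((contDiff_norm_sq ℝ).div_const 4).neg)
  decay' m n := by
    have hT : (fun x : Space d => -(‖x‖ ^ 2 / 4)).HasTemperateGrowth := by
      have h := Function.hasTemperateGrowth_norm_sq (Space d)
      have h2 := (Function.HasTemperateGrowth.const (E := Space d) (-(1 / 4 : ℝ))).mul h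
      refine (congrArg Function.HasTemperateGrowth ?_).mp h2
      funext x
      simp only [Pi.mul_apply]
      ring
    obtain ⟨k, C, hC, hb⟩ := hT.norm_iteratedFDeriv_le_uniform n
    refine ⟨n ! * (1 + C) ^ n * ((m + k * n)! * Real.exp 2), fun x => ?_⟩
    -- Faà di Bruno bound: it wants the `i`-th derivative of the exponent below the `i`-th power of
    -- one quantity. Using `1 + C` in place of `C` makes that quantity at least one, so its first
    -- power is below all the others.
    have h1 : ‖iteratedFDeriv ℝ n (Real.exp ∘ fun x : Space d => -(‖x‖ ^ 2 / 4)) x‖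
        ≤ n ! * Real.exp (-(‖x‖ ^ 2 / 4)) * ((1 + C) * (1 + ‖x‖) ^ k) ^ n := by
      refine norm_iteratedFDeriv_comp_le Real.contDiff_exp hT.1 (mod_cast le_top) x
        (fun i _ => (norm_iteratedFDeriv_real_exp i _).le) fun i hi hin => ?_
      refine (hb i hin x).trans ?_
      have h1k : 1 ≤ (1 + ‖x‖) ^ k := one_le_pow₀ (by linarith [norm_nonneg x])
      calc C * (1 + ‖x‖) ^ k ≤ (1 + C) * (1 + ‖x‖) ^ k := by gcongr; linarith
        _ ≤ ((1 + C) * (1 + ‖x‖) ^ k) ^ i :=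
          le_self_pow₀ (one_le_mul_of_one_le_of_one_le (by linarith) h1k) (by omega)
    have hx : ‖x‖ ^ m ≤ (1 + ‖x‖) ^ m := by gcongr; linarith
    have h3 := pow_mul_exp_neg_sq_le (m + k * n) (norm_nonneg x)
    calc ‖x‖ ^ m * ‖iteratedFDeriv ℝ n (fun x : Space d => Real.exp (-(‖x‖ ^ 2 / 4))) x‖
        ≤ (1 + ‖x‖) ^ m * (n ! * Real.exp (-(‖x‖ ^ 2 / 4)) * ((1 + C) * (1 + ‖x‖) ^ k) ^ n) := by
          gcongr
          exact h1
      _ = n ! * (1 + C) ^ n * ((1 + ‖x‖) ^ (m + k * n) * Real.exp (-(‖x‖ ^ 2 / 4))) := by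
          rw [mul_pow, pow_add, ← pow_mul]; ring
      _ ≤ _ := by gcongr

/-- The heat kernel at time one. -/
def gauss : 𝓢(Space d, ℝ) := ((4 * Real.pi) ^ (-(d : ℝ) / 2)) • expNegSq

lemma gauss_apply (x : Space d) :
    gauss x = (4 * Real.pi) ^ (-(d : ℝ) / 2) * Real.exp (-(‖x‖ ^ 2 / 4)) := rfl

lemma gauss_neg (x : Space d) : gauss (-x) = gauss x := by
  simp only [gauss_apply, norm_neg]

end

/-! ### Parabolic dilations -/

/-- The rescaled function `s^{-(d+m)/2} g(x/√s)`. -/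
def dil (g : Space d → ℝ) (m : ℕ) (s : ℝ) (x : Space d) : ℝ :=
  (√s)⁻¹ ^ (d + m) * g ((√s)⁻¹ • x)

lemma heatKernel_eq_dil {s : ℝ} (hs : 0 < s) : heatKernel s = dil (gauss (d := d)) 0 s := by
  funext x
  have hq : 0 < √s := Real.sqrt_pos.2 hs
  have h1 : (4 * Real.pi * s) ^ (-(d : ℝ) / 2)
      = (4 * Real.pi) ^ (-(d : ℝ) / 2) * (√s)⁻¹ ^ (d + 0) := by
    rw [Real.mul_rpow (by positivity) hs.le]
    congr 1
    rw [add_zero, inv_pow, Real.sqrt_eq_rpow, ← Real.rpow_natCast, ← Real.rpow_mul hs.le,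
      ← Real.rpow_neg hs.le]
    congr 1; ring
  have h2 : -‖x‖ ^ 2 / (4 * s) = -(‖(√s)⁻¹ • x‖ ^ 2 / 4) := by
    rw [norm_smul, mul_pow, Real.norm_of_nonneg (by positivity), inv_pow, Real.sq_sqrt hs.le]
    field_simp
  simp only [heatKernel, dil, gauss_apply, h1, h2]
  ring

/-- The index `m` counts derivatives: each one costs a factor `s^{-1/2}`. All heat-type kernels thus
become dilations of fixed Schwartz functions, and estimates are needed only at time one. -/
lemma pderiv_dil (g : 𝓢(Space d, ℝ)) (m : ℕ) (s : ℝ) (i : Fin d) :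
    pderiv i (dil g m s) = dil (∂_{(EuclideanSpace.single i 1 : Space d)} g : 𝓢(Space d, ℝ))
      (m + 1) s := by
  funext x
  have hd : HasFDerivAt g (fderiv ℝ g ((√s)⁻¹ • x)) ((√s)⁻¹ • x) :=
    (g.differentiableAt).hasFDerivAt
  have h2 : HasFDerivAt (fun y : Space d => g ((√s)⁻¹ • y))
      ((fderiv ℝ g ((√s)⁻¹ • x)).comp ((√s)⁻¹ • ContinuousLinearMap.id ℝ (Space d))) x :=
    hd.comp x ((hasFDerivAt_id x).const_smul (√s)⁻¹)
  have h3 := (h2.const_mul ((√s)⁻¹ ^ (d + m))).hasLineDerivAt (EuclideanSpace.single i 1)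
  have h4 := h3.lineDeriv
  unfold pderiv
  rw [show dil g m s = fun y => (√s)⁻¹ ^ (d + m) * g ((√s)⁻¹ • y) from rfl, h4]
  simp only [dil, SchwartzMap.lineDerivOp_apply_eq_fderiv, smul_apply,
    ContinuousLinearMap.comp_apply, ContinuousLinearMap.id_apply, map_smul, smul_eq_mul]
  ring

lemma dil_neg_of_odd {g : Space d → ℝ} (hg : ∀ x, g (-x) = -g x) (m : ℕ) (s : ℝ) (x : Space d) :
    dil g m s (-x) = -dil g m s x := by
  simp [dil, hg]

lemma continuousOn_dil {g : Space d → ℝ} (hg : Continuous g) (m : ℕ) :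
    ContinuousOn (fun p : ℝ × Space d => dil g m p.1 p.2) (Ioi 0 ×ˢ univ) := by
  have h1 : ContinuousOn (fun p : ℝ × Space d => (√p.1)⁻¹) (Ioi 0 ×ˢ univ) := by
    refine ContinuousOn.inv₀ (by fun_prop) fun p hp => ?_
    exact (Real.sqrt_pos.2 hp.1).ne'
  exact (h1.pow _).mul (hg.comp_continuousOn (h1.smul continuousOn_snd))

/-! ### Translation estimates in `L¹` -/

/-- The second difference `k(x+h) + k(x-h) - 2k(x)`. -/
def secDiff (h : Space d) (k : Space d → ℝ) (x : Space d) : ℝ := k (x + h) + k (x - h) - 2 * k x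

/-- The fundamental theorem of calculus along the segment from `x` to `x + h`, then Tonelli and
translation invariance. Here `q'` is the derivative in the direction `h`, so it already contains the
length of `h`. -/
lemma lintegral_enorm_translate_sub_le {q q' : Space d → ℝ} (h : Space d)
    (hq' : Continuous q') (hd : ∀ (x : Space d) (t : ℝ),
      HasDerivAt (fun t : ℝ => q (x + t • h)) (q' (x + t • h)) t) :
    ∫⁻ x, ‖q (x + h) - q x‖ₑ ≤ ∫⁻ x, ‖q' x‖ₑ := by
  have h1 : ∀ x, ‖q (x + h) - q x‖ₑ ≤ ∫⁻ t in Ioc (0 : ℝ) 1, ‖q' (x + t • h)‖ₑ := by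
    intro x
    have hc : Continuous fun t : ℝ => q' (x + t • h) := by fun_prop
    have := intervalIntegral.integral_eq_sub_of_hasDerivAt (a := 0) (b := 1)
      (fun t _ => hd x t) (hc.intervalIntegrable 0 1)
    simp only [one_smul, zero_smul, add_zero] at this
    rw [← this, intervalIntegral.integral_of_le zero_le_one]
    exact enorm_integral_le_lintegral_enorm _
  calc ∫⁻ x, ‖q (x + h) - q x‖ₑ
      ≤ ∫⁻ x, ∫⁻ t in Ioc (0 : ℝ) 1, ‖q' (x + t • h)‖ₑ := lintegral_mono h1
    _ = ∫⁻ t in Ioc (0 : ℝ) 1, ∫⁻ x, ‖q' (x + t • h)‖ₑ := by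
        rw [lintegral_lintegral_swap]
        refine Continuous.aemeasurable ?_
        fun_prop
    _ = ∫⁻ t in Ioc (0 : ℝ) 1, ∫⁻ x, ‖q' x‖ₑ := by
        congr 1
        funext t
        exact lintegral_add_right_eq_self (fun x => ‖q' x‖ₑ) (t • h)
    _ = ∫⁻ x, ‖q' x‖ₑ := by simp

lemma hasDerivAt_schwartz_line (g : 𝓢(Space d, ℝ)) (h x : Space d) (t : ℝ) :
    HasDerivAt (fun t : ℝ => g (x + t • h)) ((∂_{h} g : 𝓢(Space d, ℝ)) (x + t • h)) t := by
  rw [SchwartzMap.lineDerivOp_apply_eq_fderiv]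
  have h1 : HasFDerivAt g (fderiv ℝ g (x + t • h)) (x + t • h) :=
    (g.differentiableAt).hasFDerivAt
  have h2 : HasDerivAt (fun t : ℝ => x + t • h) h t := by
    simpa using ((hasDerivAt_id t).smul_const h).const_add x
  exact h1.comp_hasDerivAt t h2

lemma lintegral_enorm_schwartz_translate_le (g : 𝓢(Space d, ℝ)) (h : Space d) :
    ∫⁻ x, ‖g (x + h) - g x‖ₑ ≤ ∫⁻ x, ‖(∂_{h} g : 𝓢(Space d, ℝ)) x‖ₑ :=
  lintegral_enorm_translate_sub_le h (∂_{h} g : 𝓢(Space d, ℝ)).continuous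
    (hasDerivAt_schwartz_line g h)

/-- After a shift by `h` the second difference is a first difference of a first difference, so the
translation estimate applies twice. -/
lemma lintegral_enorm_secDiff_schwartz_le (g : 𝓢(Space d, ℝ)) (h : Space d) :
    ∫⁻ x, ‖secDiff h g x‖ₑ ≤ ∫⁻ x, ‖(∂_{h} (∂_{h} g : 𝓢(Space d, ℝ)) : 𝓢(Space d, ℝ)) x‖ₑ := by
  set g' : 𝓢(Space d, ℝ) := ∂_{h} g with hg'
  have e : ∀ x, secDiff h g x = (g (x + h) - g (x - h + h)) - (g x - g (x - h)) := by
    intro x; simp only [secDiff, sub_add_cancel]; ring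
  have e2 : ∫⁻ x, ‖secDiff h g x‖ₑ
      = ∫⁻ x, ‖(g (x + h + h) - g (x + h)) - (g (x + h) - g x)‖ₑ := by
    rw [← lintegral_add_right_eq_self (fun x => ‖secDiff h g x‖ₑ) h]
    congr 1
    funext x
    rw [e]
    simp only [add_sub_cancel_right]
  rw [e2]
  refine (lintegral_enorm_translate_sub_le (q := fun x => g (x + h) - g x)
    (q' := fun x => g' (x + h) - g' x) h ?_ fun x t => ?_).trans
    (lintegral_enorm_schwartz_translate_le g' h)
  · have := g'.continuous
    fun_prop
  · have h1 := hasDerivAt_schwartz_line g h (x + h) t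
    have h2 := hasDerivAt_schwartz_line g h x t
    simp only [add_right_comm x h] at h1
    exact h1.sub h2

lemma lintegral_enorm_lineDeriv_le (g : 𝓢(Space d, ℝ)) :
    ∃ C : ℝ, 0 ≤ C ∧ ∀ h : Space d,
      ∫⁻ x, ‖(∂_{h} g : 𝓢(Space d, ℝ)) x‖ₑ ≤ ENNReal.ofReal (C * ‖h‖) := by
  have hi := g.integrable_pow_mul_iteratedFDeriv volume 0 1
  simp only [pow_zero, one_mul] at hi
  refine ⟨∫ x, ‖iteratedFDeriv ℝ 1 g x‖, integral_nonneg fun _ => norm_nonneg _, fun h => ?_⟩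
  rw [← integral_mul_const, ofReal_integral_eq_lintegral_ofReal (hi.mul_const _)
    (ae_of_all _ fun _ => by positivity)]
  refine lintegral_mono fun x => ?_
  rw [← ofReal_norm]
  refine ENNReal.ofReal_le_ofReal ?_
  rw [SchwartzMap.lineDerivOp_apply_eq_fderiv, norm_iteratedFDeriv_one]
  exact ContinuousLinearMap.le_opNorm _ _

lemma lintegral_enorm_lineDeriv_lineDeriv_le (g : 𝓢(Space d, ℝ)) :
    ∃ C : ℝ, 0 ≤ C ∧ ∀ h : Space d,
      ∫⁻ x, ‖(∂_{h} (∂_{h} g : 𝓢(Space d, ℝ)) : 𝓢(Space d, ℝ)) x‖ₑ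
        ≤ ENNReal.ofReal (C * ‖h‖ ^ 2) := by
  have hi := g.integrable_pow_mul_iteratedFDeriv volume 0 2
  simp only [pow_zero, one_mul] at hi
  refine ⟨∫ x, ‖iteratedFDeriv ℝ 2 g x‖, integral_nonneg fun _ => norm_nonneg _, fun h => ?_⟩
  rw [← integral_mul_const, ofReal_integral_eq_lintegral_ofReal (hi.mul_const _)
    (ae_of_all _ fun _ => by positivity)]
  refine lintegral_mono fun x => ?_
  rw [← ofReal_norm]
  refine ENNReal.ofReal_le_ofReal ?_
  have e := SchwartzMap.iteratedLineDerivOp_eq_iteratedFDeriv (m := fun _ : Fin 2 => h) (f := g)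
    (x := x)
  have e' : (∂_{h} (∂_{h} g : 𝓢(Space d, ℝ)) : 𝓢(Space d, ℝ)) x
      = iteratedFDeriv ℝ 2 g x (fun _ => h) := by
    rw [← e]; rfl
  rw [e']
  refine ((iteratedFDeriv ℝ 2 g x).le_opNorm _).trans_eq ?_
  simp

/-! ### Kernels with `L¹` bounds -/

/-- `k` is integrable with `L¹` norm at most `A`, and its second differences with step `h` have
`L¹` norm at most `B|h|²`. -/
structure KernelBound (k : Space d → ℝ) (A B : ℝ) : Prop where
  meas : AEStronglyMeasurable k volume
  norm_le : ∫⁻ x, ‖k x‖ₑ ≤ ENNReal.ofReal A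
  secDiff_le : ∀ h, ∫⁻ x, ‖secDiff h k x‖ₑ ≤ ENNReal.ofReal (B * ‖h‖ ^ 2)

namespace KernelBound

lemma integrable {k : Space d → ℝ} {A B : ℝ} (hk : KernelBound k A B) : Integrable k :=
  ⟨hk.meas, hk.norm_le.trans_lt ENNReal.ofReal_lt_top⟩

lemma schwartz (g : 𝓢(Space d, ℝ)) : ∃ A B : ℝ, 0 ≤ A ∧ 0 ≤ B ∧ KernelBound g A B := by
  obtain ⟨B, hB0, hB⟩ := lintegral_enorm_lineDeriv_lineDeriv_le g
  refine ⟨∫ x, ‖g x‖, B, integral_nonneg fun _ => norm_nonneg _, hB0,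
    g.continuous.aestronglyMeasurable, ?_, fun h => ?_⟩
  · rw [ofReal_integral_norm_eq_lintegral_enorm g.integrable]
  · exact (lintegral_enorm_secDiff_schwartz_le g h).trans (hB h)

lemma lintegral_enorm_dil_le {c a : ℝ} (hc : 0 < c) (m : ℕ) (f : Space d → ℝ)
    (hf : ∫⁻ x, ‖f x‖ₑ ≤ ENNReal.ofReal a) :
    ∫⁻ x : Space d, ‖c ^ (d + m) * f (c • x)‖ₑ ≤ ENNReal.ofReal (c ^ m * a) := by
  have h1 : ∫⁻ x : Space d, ‖f (c • x)‖ₑ = ENNReal.ofReal (c ^ d)⁻¹ * ∫⁻ x, ‖f x‖ₑ := by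
    have he : MeasurableEmbedding (fun x : Space d => c • x) :=
      (Homeomorph.smulOfNeZero c hc.ne').measurableEmbedding
    rw [← he.lintegral_map (μ := volume) (fun x => ‖f x‖ₑ),
      Measure.map_addHaar_smul _ hc.ne', lintegral_smul_measure, finrank_euclideanSpace,
      Fintype.card_fin, abs_of_pos (by positivity), smul_eq_mul]
  simp only [enorm_mul]
  rw [lintegral_const_mul' _ _ enorm_ne_top, h1, Real.enorm_of_nonneg (by positivity), ← mul_assoc,
    ← ENNReal.ofReal_mul (by positivity), pow_add, mul_right_comm,
    mul_inv_cancel₀ (by positivity), one_mul, ENNReal.ofReal_mul (by positivity)]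
  gcongr

/-- The second difference of a dilate with step `h` is the dilate of the second difference with step
`h/√s`; this is the source of the extra factor `s⁻¹`. -/
lemma dil {g : Space d → ℝ} {A B : ℝ} (hg : KernelBound g A B) (m : ℕ) {s : ℝ} (hs : 0 < s) :
    KernelBound (dil g m s) ((√s)⁻¹ ^ m * A) ((√s)⁻¹ ^ (m + 2) * B) := by
  have hc : 0 < (√s)⁻¹ := inv_pos.2 (Real.sqrt_pos.2 hs)
  refine ⟨?_, lintegral_enorm_dil_le hc m g hg.norm_le, fun h => ?_⟩
  · refine AEStronglyMeasurable.const_mul ?_ _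
    exact hg.meas.comp_quasiMeasurePreserving
      (Measure.quasiMeasurePreserving_smul volume hc.ne')
  · have e : secDiff h (NavierStokes.dil g m s)
        = fun x => (√s)⁻¹ ^ (d + m) * secDiff ((√s)⁻¹ • h) g ((√s)⁻¹ • x) := by
      funext x
      simp only [secDiff, NavierStokes.dil, smul_add, smul_sub]
      ring
    rw [e]
    refine (lintegral_enorm_dil_le hc m _ (hg.secDiff_le _)).trans_eq ?_
    rw [norm_smul, Real.norm_of_nonneg hc.le]
    congr 1; ring

lemma add {k k' : Space d → ℝ} {A B A' B' : ℝ} (hk : KernelBound k A B)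
    (hk' : KernelBound k' A' B') (hA : 0 ≤ A) (hB : 0 ≤ B) (hA' : 0 ≤ A') (hB' : 0 ≤ B') :
    KernelBound (fun x => k x + k' x) (A + A') (B + B') := by
  refine ⟨hk.meas.add hk'.meas, ?_, fun h => ?_⟩
  · rw [ENNReal.ofReal_add hA hA']
    refine le_trans ?_ (add_le_add hk.norm_le hk'.norm_le)
    rw [← lintegral_add_left' hk.meas.enorm]
    exact lintegral_mono fun x => enorm_add_le _ _
  · rw [add_mul, ENNReal.ofReal_add (by positivity) (by positivity)]
    refine le_trans ?_ (add_le_add (hk.secDiff_le h) (hk'.secDiff_le h))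
    have hm : AEStronglyMeasurable (secDiff h k) volume :=
      ((hk.meas.comp_quasiMeasurePreserving
        (measurePreserving_add_right volume h).quasiMeasurePreserving).add
        (hk.meas.comp_quasiMeasurePreserving
        (measurePreserving_sub_right volume h).quasiMeasurePreserving)).sub (hk.meas.const_mul 2)
    rw [← lintegral_add_left' hm.enorm]
    refine lintegral_mono fun x => ?_
    have : secDiff h (fun x => k x + k' x) x = secDiff h k x + secDiff h k' x := by
      simp only [secDiff]; ring
    rw [this]
    exact enorm_add_le _ _

lemma zero : KernelBound (fun _ : Space d => 0) 0 0 :=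
  ⟨aestronglyMeasurable_const, by simp, by simp [secDiff]⟩

/-- The two bounds on second differences combined. -/
lemma secDiff_le_min {k : Space d → ℝ} {A B : ℝ} (hk : KernelBound k A B) (h : Space d) :
    ∫⁻ x, ‖secDiff h k x‖ₑ ≤ ENNReal.ofReal (min (4 * A) (B * ‖h‖ ^ 2)) := by
  rw [ENNReal.ofReal_min]
  refine le_min ?_ (hk.secDiff_le h)
  have e : ∀ x, ‖secDiff h k x‖ₑ ≤ ‖k (x + h)‖ₑ + ‖k (x - h)‖ₑ + 2 * ‖k x‖ₑ := by
    intro x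
    refine enorm_sub_le.trans (add_le_add (enorm_add_le _ _) ?_)
    rw [enorm_mul, Real.enorm_of_nonneg zero_le_two, ENNReal.ofReal_ofNat]
  refine (lintegral_mono e).trans ?_
  have m1 : AEMeasurable (fun x => ‖k (x + h)‖ₑ) volume :=
    (hk.meas.comp_quasiMeasurePreserving
      (measurePreserving_add_right volume h).quasiMeasurePreserving).enorm
  have m2 : AEMeasurable (fun x => ‖k (x - h)‖ₑ) volume :=
    (hk.meas.comp_quasiMeasurePreserving
      (measurePreserving_sub_right volume h).quasiMeasurePreserving).enorm
  rw [lintegral_add_left' (f := fun x => ‖k (x + h)‖ₑ + ‖k (x - h)‖ₑ) (m1.add m2), lintegral_add_left' m1,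
    lintegral_const_mul' _ _ (by simp), lintegral_add_right_eq_self (fun x => ‖k x‖ₑ),
    lintegral_sub_right_eq_self (fun x => ‖k x‖ₑ),
    ENNReal.ofReal_mul (by norm_num)]
  calc _ = 4 * ∫⁻ x, ‖k x‖ₑ := by ring
    _ ≤ _ := by
      gcongr
      · norm_num
      · exact hk.norm_le

end KernelBound

lemma KernelBound.mono {k : Space d → ℝ} {A B A' B' : ℝ} (hk : KernelBound k A B) (hA : A ≤ A')
    (hB : B ≤ B') : KernelBound k A' B' :=
  ⟨hk.meas, hk.norm_le.trans (ENNReal.ofReal_le_ofReal hA),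
    fun h => (hk.secDiff_le h).trans (ENNReal.ofReal_le_ofReal (by gcongr))⟩

/-! ### Integrals over time -/

lemma inv_sqrt_pow_eq_rpow {s : ℝ} (hs : 0 < s) (n : ℕ) :
    (√s)⁻¹ ^ n = s ^ (-(n : ℝ) / 2) := by
  rw [inv_pow, Real.sqrt_eq_rpow, ← Real.rpow_natCast, ← Real.rpow_mul hs.le,
    ← Real.rpow_neg hs.le]
  congr 1; ring

lemma lintegral_inv_sqrt_pow_le {t : ℝ} (ht : 0 < t) (p : ℕ) :
    ∫⁻ s in Ioi t, ENNReal.ofReal ((√s)⁻¹ ^ (p + 3)) ≤ ENNReal.ofReal (2 * (√t)⁻¹ ^ (p + 1)) := by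
  have ha : -((p + 3 : ℕ) : ℝ) / 2 < -1 := by push_cast; linarith [p.cast_nonneg (α := ℝ)]
  have e : ∫⁻ s in Ioi t, ENNReal.ofReal ((√s)⁻¹ ^ (p + 3))
      = ∫⁻ s in Ioi t, ENNReal.ofReal (s ^ (-((p + 3 : ℕ) : ℝ) / 2)) := by
    refine setLIntegral_congr_fun measurableSet_Ioi fun s hs => ?_
    simp only [inv_sqrt_pow_eq_rpow (ht.trans hs)]
  rw [e, ← ofReal_integral_eq_lintegral_ofReal (integrableOn_Ioi_rpow_of_lt ha ht)
    ((ae_restrict_mem measurableSet_Ioi).mono fun s hs => by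
      have : 0 < s := ht.trans hs
      positivity), integral_Ioi_rpow_of_lt ha ht, inv_sqrt_pow_eq_rpow ht]
  refine ENNReal.ofReal_le_ofReal ?_
  have e2 : -((p + 3 : ℕ) : ℝ) / 2 + 1 = -((p + 1 : ℕ) : ℝ) / 2 := by push_cast; ring
  rw [e2, neg_div, ← div_neg]
  have hp : (0 : ℝ) ≤ t ^ (-((p + 1 : ℕ) : ℝ) / 2) := by positivity
  rw [div_le_iff₀ (by push_cast; linarith [p.cast_nonneg (α := ℝ)])]
  push_cast at hp ⊢
  nlinarith [p.cast_nonneg (α := ℝ), mul_nonneg (p.cast_nonneg (α := ℝ)) hp]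

/-! ### The kernel `∫_t^∞ g_s ds` -/

/-- The kernel `∫_t^∞ g_s ds`, where `g_s = s^{-(d+3)/2} g(·/√s)`. -/
def tailKernel (g : Space d → ℝ) (t : ℝ) (x : Space d) : ℝ := ∫ s in Ioi t, dil g 3 s x

lemma integrableOn_dil (g : 𝓢(Space d, ℝ)) {t : ℝ} (ht : 0 < t) (x : Space d) :
    IntegrableOn (fun s => dil g 3 s x) (Ioi t) := by
  obtain ⟨C, hC, hg⟩ := g.decay 0 0
  simp only [pow_zero, one_mul, norm_iteratedFDeriv_zero] at hg
  have hm : AEStronglyMeasurable (fun s => dil g 3 s x) (volume.restrict (Ioi t)) := by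
    refine ContinuousOn.aestronglyMeasurable ?_ measurableSet_Ioi
    refine ((continuousOn_dil g.continuous 3).comp (f := fun s => (s, x)) (by fun_prop)
      fun s hs => ⟨ht.trans hs, mem_univ _⟩)
  have ha : -((d + 3 : ℕ) : ℝ) / 2 < -1 := by push_cast; linarith [d.cast_nonneg (α := ℝ)]
  refine ((integrableOn_Ioi_rpow_of_lt ha ht).mul_const C).mono' hm ?_
  filter_upwards [ae_restrict_mem measurableSet_Ioi] with s hs
  have h0 : 0 < s := ht.trans hs
  rw [dil, norm_mul, Real.norm_of_nonneg (by positivity), inv_sqrt_pow_eq_rpow h0]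
  gcongr
  exact hg _

lemma aestronglyMeasurable_uncurry_dil (g : 𝓢(Space d, ℝ)) {t : ℝ} (ht : 0 ≤ t) :
    AEStronglyMeasurable (fun p : ℝ × Space d => dil g 3 p.1 p.2)
      ((volume.restrict (Ioi t)).prod volume) := by
  have h : (volume.restrict (Ioi t)).prod (volume : Measure (Space d))
      = ((volume : Measure ℝ).prod volume).restrict (Ioi t ×ˢ univ) := by
    rw [← Measure.prod_restrict, Measure.restrict_univ]
  rw [h]
  exact ((continuousOn_dil g.continuous 3).mono
    (prod_mono_left (Ioi_subset_Ioi ht))).aestronglyMeasurable (measurableSet_Ioi.prod .univ)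

/-- Minkowski's inequality in the form of Tonelli's theorem. It serves with `p = 0` for `L¹` norms
and with `p = 2` for second differences, which decay faster by `s⁻¹`. -/
lemma lintegral_lintegral_dil_le {t A : ℝ} (ht : 0 < t) (p : ℕ)
    (F : ℝ → Space d → ℝ) (hA : 0 ≤ A)
    (hF : AEStronglyMeasurable (fun q : ℝ × Space d => F q.1 q.2)
      ((volume.restrict (Ioi t)).prod volume))
    (hb : ∀ s, t < s → ∫⁻ x, ‖F s x‖ₑ ≤ ENNReal.ofReal ((√s)⁻¹ ^ (p + 3) * A)) :
    ∫⁻ x, ‖∫ s in Ioi t, F s x‖ₑ ≤ ENNReal.ofReal (2 * (√t)⁻¹ ^ (p + 1) * A) := by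
  calc ∫⁻ x, ‖∫ s in Ioi t, F s x‖ₑ
      ≤ ∫⁻ x, ∫⁻ s in Ioi t, ‖F s x‖ₑ := lintegral_mono fun x => enorm_integral_le_lintegral_enorm _
    _ = ∫⁻ s in Ioi t, ∫⁻ x, ‖F s x‖ₑ := (lintegral_lintegral_swap hF.enorm).symm
    _ ≤ ∫⁻ s in Ioi t, ENNReal.ofReal ((√s)⁻¹ ^ (p + 3) * A) :=
        setLIntegral_mono' measurableSet_Ioi fun s hs => hb s hs
    _ ≤ _ := by
        simp only [ENNReal.ofReal_mul' hA]
        rw [lintegral_mul_const' _ _ ENNReal.ofReal_ne_top]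
        gcongr
        exact lintegral_inv_sqrt_pow_le ht p

lemma kernelBound_tailKernel (g : 𝓢(Space d, ℝ)) {A B : ℝ} (hA : 0 ≤ A) (hB : 0 ≤ B)
    (hg : KernelBound g A B) {t : ℝ} (ht : 0 < t) :
    KernelBound (tailKernel g t) (2 * (√t)⁻¹ ^ 1 * A) (2 * (√t)⁻¹ ^ 3 * B) := by
  have hm := aestronglyMeasurable_uncurry_dil g ht.le
  refine ⟨hm.prod_swap.integral_prod_right', ?_, fun h => ?_⟩
  · exact lintegral_lintegral_dil_le ht 0 (dil g 3) hA hm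
      fun s hs => (hg.dil 3 (ht.trans hs)).norm_le
  · have e : ∀ x, secDiff h (tailKernel g t) x = ∫ s in Ioi t, secDiff h (dil g 3 s) x := by
      intro x
      have i1 := integrableOn_dil g ht (x + h)
      have i2 := integrableOn_dil g ht (x - h)
      have i3 := integrableOn_dil g ht x
      simp only [secDiff, tailKernel]
      rw [integral_sub (f := fun s => dil g 3 s (x + h) + dil g 3 s (x - h)) (i1.add i2)
        (i3.const_mul 2), integral_add i1 i2, integral_const_mul]
    simp only [e]
    rw [mul_assoc]
    refine lintegral_lintegral_dil_le ht 2 (fun s => secDiff h (dil g 3 s)) (by positivity) ?_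
      fun s hs => ((hg.dil 3 (ht.trans hs)).secDiff_le h).trans_eq (by ring_nf)
    have hshift : ∀ y : Space d, AEStronglyMeasurable
        (fun p : ℝ × Space d => dil g 3 p.1 (p.2 + y)) ((volume.restrict (Ioi t)).prod volume) :=
      fun y => hm.comp_quasiMeasurePreserving
        ((MeasurePreserving.id (volume.restrict (Ioi t))).prod
          (measurePreserving_add_right volume y)).quasiMeasurePreserving
    have := hshift (-h)
    simp only [← sub_eq_add_neg] at this
    exact ((hshift h).add this).sub (hm.const_mul 2)

/-! ### Continuity in time -/

/-- An integrable majorant, uniform for `t` in a compact subinterval of `(0, ∞)`, for use in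
dominated convergence: `1 + |x| ≤ (1 + √b)(1 + |x|/√t)` transfers the Schwartz decay of `g`, and the
exponent `d + 1` exceeds the dimension. -/
lemma exists_dil_le (g : 𝓢(Space d, ℝ)) (m : ℕ) {a b : ℝ} (ha : 0 < a) :
    ∃ D : ℝ, ∀ t, a ≤ t → t ≤ b → ∀ x : Space d,
      ‖dil g m t x‖ ≤ D * (1 + ‖x‖) ^ (-((d + 1 : ℕ) : ℝ)) := by
  obtain ⟨C, hC⟩ : ∃ C : ℝ, ∀ x, (1 + ‖x‖) ^ (d + 1) * ‖g x‖ ≤ C := by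
    refine ⟨2 ^ (d + 1) * ((Finset.Iic (d + 1, 0)).sup
      fun m => SchwartzMap.seminorm ℝ m.1 m.2) g, fun x => ?_⟩
    have := SchwartzMap.one_add_le_sup_seminorm_apply (𝕜 := ℝ) (m := (d + 1, 0)) (le_refl (d + 1))
      (le_refl 0) g x
    rwa [norm_iteratedFDeriv_zero] at this
  have hC0 : 0 ≤ C := le_trans (by positivity) (hC 0)
  refine ⟨(√a)⁻¹ ^ (d + m) * (C * (1 + √b) ^ (d + 1)), fun t hat htb x => ?_⟩
  have ht : 0 < t := ha.trans_le hat
  have hq : 0 < √t := Real.sqrt_pos.2 ht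
  have hqb : √t ≤ √b := Real.sqrt_le_sqrt htb
  have hx : 1 + ‖x‖ ≤ (1 + √b) * (1 + ‖(√t)⁻¹ • x‖) := by
    rw [norm_smul, Real.norm_of_nonneg (by positivity)]
    have e : ‖x‖ = √t * ((√t)⁻¹ * ‖x‖) := by field_simp
    have h0 : 0 ≤ (√t)⁻¹ * ‖x‖ := by positivity
    have : √t * ((√t)⁻¹ * ‖x‖) ≤ √b * ((√t)⁻¹ * ‖x‖) := by gcongr
    nlinarith [Real.sqrt_nonneg b]
  have h1 : ‖g ((√t)⁻¹ • x)‖ ≤ C * (1 + √b) ^ (d + 1) * ((1 + ‖x‖) ^ (d + 1))⁻¹ := by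
    rw [← div_eq_mul_inv, le_div_iff₀ (by positivity)]
    calc ‖g ((√t)⁻¹ • x)‖ * (1 + ‖x‖) ^ (d + 1)
        ≤ ‖g ((√t)⁻¹ • x)‖ * ((1 + √b) * (1 + ‖(√t)⁻¹ • x‖)) ^ (d + 1) := by gcongr
      _ = ((1 + ‖(√t)⁻¹ • x‖) ^ (d + 1) * ‖g ((√t)⁻¹ • x)‖) * (1 + √b) ^ (d + 1) := by
          rw [mul_pow]; ring
      _ ≤ _ := by gcongr; exact hC _
  rw [Real.rpow_neg (by positivity), Real.rpow_natCast, dil, norm_mul,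
    Real.norm_of_nonneg (by positivity), mul_assoc]
  have hqa : (√t)⁻¹ ≤ (√a)⁻¹ := by
    have := Real.sqrt_pos.2 ha
    gcongr
  gcongr

lemma tendsto_lintegral_dil_sub (g : 𝓢(Space d, ℝ)) (m : ℕ) {t₀ : ℝ} (ht₀ : 0 < t₀) :
    Tendsto (fun t => ∫⁻ x, ‖dil g m t x - dil g m t₀ x‖ₑ) (𝓝 t₀) (𝓝 0) := by
  obtain ⟨D, hD⟩ := exists_dil_le g m (a := t₀ / 2) (b := 2 * t₀) (by linarith)
  have hi : Integrable (fun x : Space d => D * (1 + ‖x‖) ^ (-((d + 1 : ℕ) : ℝ))) :=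
    (integrable_one_add_norm (by rw [finrank_euclideanSpace, Fintype.card_fin]; simp)).const_mul D
  have hcont : ∀ t, Continuous (dil (g : Space d → ℝ) m t) := fun t => by
    unfold dil
    have := g.continuous
    fun_prop
  have h := tendsto_lintegral_filter_of_dominated_convergence (μ := (volume : Measure (Space d)))
    (l := 𝓝 t₀) (F := fun t x => ‖dil g m t x - dil g m t₀ x‖ₑ) (f := fun _ => 0)
    (fun x => ENNReal.ofReal (2 * (D * (1 + ‖x‖) ^ (-((d + 1 : ℕ) : ℝ)))))
    (Eventually.of_forall fun t => ((hcont t).sub (hcont t₀)).enorm.measurable) ?_ ?_ ?_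
  · simpa using h
  · filter_upwards [Icc_mem_nhds (show t₀ / 2 < t₀ by linarith) (show t₀ < 2 * t₀ by linarith)]
      with t ht
    refine ae_of_all _ fun x => ?_
    rw [← ofReal_norm]
    refine ENNReal.ofReal_le_ofReal ((norm_sub_le _ _).trans ?_)
    have h1 := hD t ht.1 ht.2 x
    have h2 := hD t₀ (by linarith) (by linarith) x
    linarith
  · exact ((hi.const_mul 2).lintegral_lt_top).ne
  · refine ae_of_all _ fun x => ?_
    have hc : ContinuousAt (fun t => dil g m t x) t₀ := by
      have := (continuousOn_dil g.continuous m).comp (f := fun s : ℝ => (s, x)) (s := Ioi 0)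
        (by fun_prop) fun s hs => ⟨hs, mem_univ _⟩
      exact this.continuousAt (Ioi_mem_nhds ht₀)
    have := (hc.tendsto.sub_const (dil g m t₀ x)).enorm
    simpa using this

/-- The two tails differ by an integral over the times between `t` and `t₀`, where the integrand is
bounded in `L¹` because those times stay above `t₀/2`; the difference is therefore Lipschitz in
time. -/
lemma tendsto_lintegral_tailKernel_sub (g : 𝓢(Space d, ℝ)) {t₀ : ℝ} (ht₀ : 0 < t₀) :
    Tendsto (fun t => ∫⁻ x, ‖tailKernel g t x - tailKernel g t₀ x‖ₑ) (𝓝 t₀) (𝓝 0) := by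
  obtain ⟨A, B, hA, hB, hg⟩ := KernelBound.schwartz g
  set a := t₀ / 2 with ha
  have ha0 : 0 < a := by positivity
  have hb : ∀ᶠ t in 𝓝 t₀, ∫⁻ x, ‖tailKernel g t x - tailKernel g t₀ x‖ₑ
      ≤ ENNReal.ofReal ((√a)⁻¹ ^ 3 * A * |t₀ - t|) := by
    filter_upwards [Ioi_mem_nhds (show a < t₀ by rw [ha]; linarith)] with t ht
    have hat : a < t := ht
    have hsub : uIoc t t₀ ⊆ Ioi a := fun s hs => by
      have := hs.1
      have h2 : a < min t t₀ := lt_min hat (by rw [ha]; linarith)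
      exact h2.trans this
    have e : ∀ x, tailKernel g t x - tailKernel g t₀ x = ∫ s in t..t₀, dil g 3 s x := fun x =>
      intervalIntegral.integral_Ioi_sub_Ioi' (integrableOn_dil g (ha0.trans hat) x)
        (integrableOn_dil g ht₀ x)
    have hm : AEStronglyMeasurable (fun p : ℝ × Space d => dil g 3 p.1 p.2)
        ((volume.restrict (uIoc t t₀)).prod volume) :=
      (aestronglyMeasurable_uncurry_dil g ha0.le).mono_measure
        (Measure.prod_mono (Measure.restrict_mono hsub le_rfl) le_rfl)
    calc ∫⁻ x, ‖tailKernel g t x - tailKernel g t₀ x‖ₑ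
        ≤ ∫⁻ x, ∫⁻ s in uIoc t t₀, ‖dil g 3 s x‖ₑ := by
          refine lintegral_mono fun x => ?_
          rw [e, ← enorm_norm, intervalIntegral.norm_integral_eq_norm_integral_uIoc, enorm_norm]
          exact enorm_integral_le_lintegral_enorm _
      _ = ∫⁻ s in uIoc t t₀, ∫⁻ x, ‖dil g 3 s x‖ₑ := (lintegral_lintegral_swap hm.enorm).symm
      _ ≤ ∫⁻ s in uIoc t t₀, ENNReal.ofReal ((√a)⁻¹ ^ 3 * A) := by
          refine setLIntegral_mono' measurableSet_uIoc fun s hs => ?_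
          have has : a < s := hsub hs
          refine ((hg.dil 3 (ha0.trans has)).norm_le).trans (ENNReal.ofReal_le_ofReal ?_)
          have := Real.sqrt_pos.2 ha0
          gcongr
      _ = _ := by
          rw [setLIntegral_const, uIoc, Real.volume_Ioc, max_sub_min_eq_abs,
            ← ENNReal.ofReal_mul (by positivity)]
  refine tendsto_of_tendsto_of_tendsto_of_le_of_le' tendsto_const_nhds ?_
    (Eventually.of_forall fun _ => zero_le) hb
  have : Tendsto (fun t => (√a)⁻¹ ^ 3 * A * |t₀ - t|) (𝓝 t₀) (𝓝 ((√a)⁻¹ ^ 3 * A * |t₀ - t₀|)) :=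
    (Continuous.tendsto (by fun_prop) _)
  simpa using ENNReal.tendsto_ofReal this

/-! ### Parity -/

/-- The factor `c = ±1` handles both parities at once, so that oddness of the third derivatives of
the Gaussian follows by iteration. -/
lemma lineDerivOp_neg_apply {g : 𝓢(Space d, ℝ)} {c : ℝ} (hg : ∀ x, g (-x) = c * g x)
    (h x : Space d) :
    (∂_{h} g : 𝓢(Space d, ℝ)) (-x) = -c * (∂_{h} g : 𝓢(Space d, ℝ)) x := by
  simp only [SchwartzMap.lineDerivOp_apply_eq_fderiv]
  have h1 : fderiv ℝ (fun y => g (-y)) x = -fderiv ℝ g (-x) := by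
    have h := (g.differentiableAt (x := -x)).hasFDerivAt.comp x (hasFDerivAt_id x).neg
    rw [show (fun y => g (-y)) = g ∘ Neg.neg from rfl, h.fderiv]
    ext v
    simp
  have h2 : fderiv ℝ (fun y => g (-y)) x = c • fderiv ℝ g x := by
    simp only [hg]
    exact fderiv_const_mul g.differentiableAt c
  have h3 : fderiv ℝ g (-x) = -(c • fderiv ℝ g x) := by rw [← h2, h1, neg_neg]
  rw [h3]
  simp

/-! ### The heat and Oseen kernels -/

/-- `∂_k Γ_1`. -/
def gaussDeriv (k : Fin d) : 𝓢(Space d, ℝ) :=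
  ∂_{(EuclideanSpace.single k 1 : Space d)} (gauss : 𝓢(Space d, ℝ))

/-- `∂_i ∂_j ∂_k Γ_1`. -/
def gaussDeriv₃ (i j k : Fin d) : 𝓢(Space d, ℝ) :=
  ∂_{(EuclideanSpace.single i 1 : Space d)} (∂_{(EuclideanSpace.single j 1 : Space d)}
    (gaussDeriv k : 𝓢(Space d, ℝ)) : 𝓢(Space d, ℝ))

lemma gaussDeriv_neg (k : Fin d) (x : Space d) : gaussDeriv k (-x) = -gaussDeriv k x := by
  have := lineDerivOp_neg_apply (g := gauss) (c := 1) (fun x => by rw [gauss_neg, one_mul])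
    (EuclideanSpace.single k 1) x
  simpa [gaussDeriv] using this

lemma gaussDeriv₃_neg (i j k : Fin d) (x : Space d) :
    gaussDeriv₃ i j k (-x) = -gaussDeriv₃ i j k x := by
  have h1 := lineDerivOp_neg_apply (g := gaussDeriv k) (c := -1)
    (fun x => by rw [gaussDeriv_neg, neg_one_mul]) (EuclideanSpace.single j 1)
  have h2 := lineDerivOp_neg_apply (c := 1)
    (fun x => (h1 x).trans (by rw [neg_neg])) (EuclideanSpace.single i 1) x
  simpa [gaussDeriv₃] using h2

lemma oseenKernel_eq {t : ℝ} (ht : 0 < t) (i j k : Fin d) :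
    oseenKernel t i j k = fun x => (if i = j then dil (gaussDeriv k) 1 t x else 0)
      + tailKernel (gaussDeriv₃ i j k) t x := by
  funext x
  unfold oseenKernel
  congr 1
  · rw [heatKernel_eq_dil ht, pderiv_dil]; rfl
  · refine setIntegral_congr_fun measurableSet_Ioi fun s hs => ?_
    rw [heatKernel_eq_dil (ht.trans hs), pderiv_dil, pderiv_dil, pderiv_dil]
    rfl

lemma oseenKernel_neg {t : ℝ} (ht : 0 < t) (i j k : Fin d) (x : Space d) :
    oseenKernel t i j k (-x) = -oseenKernel t i j k x := by
  simp only [oseenKernel_eq ht, tailKernel, dil_neg_of_odd (gaussDeriv_neg k),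
    dil_neg_of_odd (gaussDeriv₃_neg i j k), integral_neg]
  split_ifs <;> ring

/-- The kernel is odd. This cancellation is what removes the lowest frequencies of the Duhamel term.
-/
lemma integral_oseenKernel {t : ℝ} (ht : 0 < t) (i j k : Fin d) :
    ∫ x, oseenKernel t i j k x = 0 := by
  have h := integral_neg_eq_self (oseenKernel t i j k) (volume : Measure (Space d))
  simp only [oseenKernel_neg ht, integral_neg] at h
  linarith

/-- Both pieces of the kernel are parabolic dilations, or time integrals of them, of fixed Schwartz
functions. Summing the constants over all indices makes them uniform in `i, j, k`; the factor 2
comes from the time integral. -/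
lemma exists_kernelBound_oseenKernel (d : ℕ) : ∃ A B : ℝ, 0 ≤ A ∧ 0 ≤ B ∧
    ∀ (t : ℝ), 0 < t → ∀ i j k : Fin d,
      KernelBound (oseenKernel t i j k) (A * (√t)⁻¹) (B * (√t)⁻¹ ^ 3) := by
  choose A₁ B₁ hA₁ hB₁ h₁ using fun k : Fin d => KernelBound.schwartz (gaussDeriv k)
  choose A₃ B₃ hA₃ hB₃ h₃ using fun q : Fin d × Fin d × Fin d =>
    KernelBound.schwartz (gaussDeriv₃ q.1 q.2.1 q.2.2)
  have le₁ : ∀ (f : Fin d → ℝ), (∀ k, 0 ≤ f k) → ∀ k, f k ≤ ∑ l, f l := fun f hf k =>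
    Finset.single_le_sum (fun l _ => hf l) (Finset.mem_univ k)
  have le₃ : ∀ (f : Fin d × Fin d × Fin d → ℝ), (∀ k, 0 ≤ f k) → ∀ k, f k ≤ ∑ l, f l :=
    fun f hf k => Finset.single_le_sum (fun l _ => hf l) (Finset.mem_univ k)
  have s1 := Finset.sum_nonneg fun l (_ : l ∈ Finset.univ) => hA₁ l
  have s2 := Finset.sum_nonneg fun l (_ : l ∈ Finset.univ) => hA₃ l
  have s3 := Finset.sum_nonneg fun l (_ : l ∈ Finset.univ) => hB₁ l
  have s4 := Finset.sum_nonneg fun l (_ : l ∈ Finset.univ) => hB₃ l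
  refine ⟨∑ l, A₁ l + 2 * ∑ l, A₃ l, ∑ l, B₁ l + 2 * ∑ l, B₃ l, by positivity, by positivity,
    fun t ht i j k => ?_⟩
  have hc : 0 < (√t)⁻¹ := inv_pos.2 (Real.sqrt_pos.2 ht)
  have k1 : KernelBound (fun x => if i = j then dil (gaussDeriv k) 1 t x else 0)
      ((√t)⁻¹ ^ 1 * A₁ k) ((√t)⁻¹ ^ 3 * B₁ k) := by
    split_ifs
    · exact (h₁ k).dil 1 ht
    · exact KernelBound.zero.mono (by have := hA₁ k; positivity) (by have := hB₁ k; positivity)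
  have k3 := kernelBound_tailKernel (gaussDeriv₃ i j k) (hA₃ (i, j, k)) (hB₃ (i, j, k))
    (h₃ (i, j, k)) ht
  rw [oseenKernel_eq ht]
  have a1 := hA₁ k
  have a2 := hA₃ (i, j, k)
  have a3 := hB₁ k
  have a4 := hB₃ (i, j, k)
  refine (k1.add k3 (by positivity) (by positivity) (by positivity) (by positivity)).mono ?_ ?_
  · have b1 := le₁ A₁ hA₁ k
    have b2 := le₃ A₃ hA₃ (i, j, k)
    nlinarith
  · have b1 := le₁ B₁ hB₁ k
    have b2 := le₃ B₃ hB₃ (i, j, k)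
    have : 0 < (√t)⁻¹ ^ 3 := by positivity
    nlinarith

/-! ### The kernels as elements of `L¹` -/

/-- An integrable function as an element of `L¹`. -/
def toLOne (k : Space d → ℝ) : LOne d := by
  classical exact if h : Integrable k then h.toL1 k else 0

lemma toLOne_eq {k : Space d → ℝ} (hk : Integrable k) : toLOne k = hk.toL1 k := dif_pos hk

lemma KernelBound.norm_toLOne_le {k : Space d → ℝ} {A B : ℝ} (hk : KernelBound k A B)
    (hA : 0 ≤ A) : ‖toLOne k‖ ≤ A := by
  rw [toLOne_eq hk.integrable, norm_toL1_eq, integral_norm_eq_lintegral_enorm hk.meas]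
  exact ENNReal.toReal_le_of_le_ofReal hA hk.norm_le

lemma conv_toLOne_apply {k : Space d → ℝ} (hk : Integrable k) (f : LInfty d) (x : Space d) :
    conv (toLOne k) f x = ∫ y, k (x - y) • f y := by
  rw [toLOne_eq hk, conv_toL1_apply]

lemma continuousOn_toLOne {k : ℝ → Space d → ℝ} (hk : ∀ t, 0 < t → Integrable (k t))
    (h : ∀ t₀, 0 < t₀ → Tendsto (fun t => ∫⁻ x, ‖k t x - k t₀ x‖ₑ) (𝓝 t₀) (𝓝 0)) :
    ContinuousOn (fun t => toLOne (k t)) (Ioi 0) := by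
  intro t₀ ht₀
  refine ContinuousAt.continuousWithinAt ?_
  rw [ContinuousAt, tendsto_iff_edist_tendsto_0]
  refine (h t₀ ht₀).congr' ?_
  filter_upwards [Ioi_mem_nhds ht₀] with t ht
  rw [toLOne_eq (hk t ht), toLOne_eq (hk t₀ ht₀), Integrable.edist_toL1_toL1]
  simp only [edist_eq_enorm_sub]

lemma exists_kernelBound_heatKernel (d : ℕ) : ∃ A : ℝ, 0 ≤ A ∧
    ∀ t : ℝ, 0 < t → ∃ B, KernelBound (heatKernel t : Space d → ℝ) A B := by
  obtain ⟨A, B, hA, hB, h⟩ := KernelBound.schwartz (gauss : 𝓢(Space d, ℝ))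
  refine ⟨A, hA, fun t ht => ⟨(√t)⁻¹ ^ (0 + 2) * B, ?_⟩⟩
  rw [heatKernel_eq_dil ht]
  have := h.dil 0 ht
  rwa [pow_zero, one_mul] at this

lemma continuousOn_toLOne_heatKernel :
    ContinuousOn (fun t => toLOne (heatKernel t : Space d → ℝ)) (Ioi 0) := by
  obtain ⟨A, -, hA⟩ := exists_kernelBound_heatKernel d
  refine continuousOn_toLOne (fun t ht => (hA t ht).choose_spec.integrable) fun t₀ ht₀ => ?_
  refine (tendsto_lintegral_dil_sub (gauss (d := d)) 0 ht₀).congr' ?_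
  filter_upwards [Ioi_mem_nhds ht₀] with t ht
  rw [heatKernel_eq_dil ht, heatKernel_eq_dil ht₀]

lemma continuousOn_toLOne_oseenKernel (i j k : Fin d) :
    ContinuousOn (fun t => toLOne (oseenKernel t i j k)) (Ioi 0) := by
  obtain ⟨A, B, -, -, hAB⟩ := exists_kernelBound_oseenKernel d
  refine continuousOn_toLOne (fun t ht => (hAB t ht i j k).integrable) fun t₀ ht₀ => ?_
  have h := (tendsto_lintegral_dil_sub (gaussDeriv k) 1 ht₀).add
    (tendsto_lintegral_tailKernel_sub (gaussDeriv₃ i j k) ht₀)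
  rw [add_zero] at h
  refine tendsto_of_tendsto_of_tendsto_of_le_of_le' tendsto_const_nhds h
    (Eventually.of_forall fun _ => zero_le) ?_
  filter_upwards [Ioi_mem_nhds ht₀] with t ht
  have hm : Measurable fun x => ‖dil (gaussDeriv k) 1 t x - dil (gaussDeriv k) 1 t₀ x‖ₑ := by
    refine Continuous.measurable ?_
    unfold dil
    have := (gaussDeriv k).continuous
    fun_prop
  rw [← lintegral_add_left hm, oseenKernel_eq ht, oseenKernel_eq ht₀]
  refine lintegral_mono fun x => ?_
  have e : ∀ a b a' b' : ℝ, a + b - (a' + b') = (a - a') + (b - b') := fun _ _ _ _ => by ring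
  rw [e]
  refine (enorm_add_le _ _).trans (add_le_add ?_ le_rfl)
  split_ifs
  · exact le_rfl
  · simp

/-! ### The low-frequency cut-off of a Littlewood-Paley partition -/

/-- The cut-off is `∑_{j ≤ 0} φ(2^{-j} ξ)` away from the origin, but it is defined as one minus the
sum over `j ≥ 1`. The latter sum is locally finite even near zero, which gives smoothness there and
the value one. For `|ξ| > R` the terms with `j ≤ 0` vanish, so the sum over `j ≥ 1` is already one;
the dyadic difference telescopes. -/
lemma IsLittlewoodPaley.exists_cutoff {φ : Space d → ℝ} (hφ : IsLittlewoodPaley φ) :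
    ∃ Φ : Space d → ℝ, ContDiff ℝ ∞ Φ ∧ HasCompactSupport Φ ∧ Φ 0 = 1 ∧
      (∀ ξ, Φ (-ξ) = Φ ξ) ∧ ∀ ξ, Φ ξ - Φ ((2 : ℝ) • ξ) = φ ξ := by
  obtain ⟨r, R, hr, hann⟩ := hφ.annulus
  let ψ : ℕ → Space d → ℝ := fun n ξ => φ (((2 : ℝ) ^ (n + 1))⁻¹ • ξ)
  have hnorm : ∀ (n : ℕ) (ξ : Space d), ‖((2 : ℝ) ^ n)⁻¹ • ξ‖ = ((2 : ℝ) ^ n)⁻¹ * ‖ξ‖ :=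
    fun n ξ => by rw [norm_smul, Real.norm_of_nonneg (by positivity)]
  have hzero : ∀ (N : ℕ) (ξ : Space d), ‖ξ‖ < 2 ^ N * r → ∀ n, n ∉ Finset.range N →
      ψ n ξ = 0 := by
    intro N ξ hξ n hn
    by_contra hc
    have h1 := (hann _ hc).1
    rw [hnorm, ← div_eq_inv_mul, le_div_iff₀ (by positivity)] at h1
    have h2 : (2 : ℝ) ^ N ≤ 2 ^ (n + 1) :=
      pow_le_pow_right₀ one_le_two (by rw [Finset.mem_range] at hn; omega)
    nlinarith
  have hN : ∀ ρ : ℝ, ∃ N : ℕ, ρ < 2 ^ N * r := by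
    intro ρ
    obtain ⟨N, hN⟩ := pow_unbounded_of_one_lt (ρ / r) (one_lt_two : (1 : ℝ) < 2)
    exact ⟨N, by rwa [div_lt_iff₀ hr] at hN⟩
  have hsum : ∀ ξ, Summable fun n => ψ n ξ := fun ξ => by
    obtain ⟨N, hN⟩ := hN ‖ξ‖
    exact summable_of_ne_finset_zero (hzero N ξ hN)
  refine ⟨fun ξ => 1 - ∑' n, ψ n ξ, ?_, ?_, ?_, ?_, ?_⟩
  · rw [contDiff_iff_contDiffAt]
    intro ξ₀
    obtain ⟨N, hN⟩ := hN (‖ξ₀‖ + 1)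
    have hs : ContDiff ℝ ∞ fun ξ => 1 - ∑ n ∈ Finset.range N, ψ n ξ := by
      refine contDiff_const.sub (ContDiff.sum fun n _ => ?_)
      exact hφ.contDiff.comp (contDiff_const_smul _)
    refine hs.contDiffAt.congr_of_eventuallyEq ?_
    filter_upwards [Metric.ball_mem_nhds ξ₀ one_pos] with ξ hξ
    have : ‖ξ‖ < 2 ^ N * r := by
      rw [mem_ball_iff_norm] at hξ
      have := norm_sub_norm_le ξ ξ₀
      linarith
    rw [tsum_eq_sum (hzero N ξ this)]
  · refine HasCompactSupport.intro (isCompact_closedBall 0 (max R 0)) fun ξ hξ => ?_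
    rw [mem_closedBall_zero_iff, not_le, max_lt_iff] at hξ
    have hξ0 : ξ ≠ 0 := norm_pos_iff.1 hξ.2
    have h := hφ.partition ξ hξ0
    have hinj : Function.Injective (fun n : ℕ => (n + 1 : ℤ)) := fun a b hab => by
      simpa using hab
    rw [← hinj.hasSum_iff] at h
    · have e : (fun j : ℤ => φ ((2 : ℝ) ^ (-j) • ξ)) ∘ (fun n : ℕ => (n + 1 : ℤ))
          = fun n => ψ n ξ := by
        funext n
        simp only [Function.comp, ψ, zpow_neg]
        norm_cast
      rw [e] at h
      rw [h.tsum_eq, sub_self]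
    · intro j hj
      have hj0 : j ≤ 0 := by
        by_contra! hc
        exact hj ⟨(j - 1).toNat, by simp only; omega⟩
      by_contra hc
      have h1 := (hann _ hc).2
      rw [norm_smul, Real.norm_of_nonneg (by positivity)] at h1
      have h2 : (1 : ℝ) ≤ 2 ^ (-j) := one_le_zpow₀ one_le_two (by omega)
      nlinarith
  · have h0 : ∀ n, ψ n 0 = 0 := fun n =>
      hzero 0 0 (by simpa using hr) n (by simp)
    simp [h0]
  · intro ξ
    have : ∀ n, ψ n (-ξ) = ψ n ξ := fun n => hφ.radial _ _ (by rw [smul_neg, norm_neg])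
    simp only [this]
  · intro ξ
    have h0 := (hsum ((2 : ℝ) • ξ)).tsum_eq_zero_add
    have h1 : ψ 0 ((2 : ℝ) • ξ) = φ ξ := by simp [ψ, smul_smul]
    have h2 : ∀ n, ψ (n + 1) ((2 : ℝ) • ξ) = ψ n ξ := fun n => by
      simp only [ψ, smul_smul]
      congr 2
      field_simp
      ring
    simp only [h1, h2] at h0
    simp only [h0]
    ring

/-- The kernel `2^{jd} K(2^j ·)`. -/
def dyadicDil (K : Space d → ℝ) (j : ℤ) (x : Space d) : ℝ :=
  ((2 : ℝ) ^ j) ^ d * K ((2 : ℝ) ^ j • x)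

lemma fourierInv_comp_smul (f : Space d → ℂ) {c : ℝ} (hc : 0 < c) (x : Space d) :
    𝓕⁻ (fun ξ => f (c⁻¹ • ξ)) x = ((c ^ d : ℝ) : ℂ) * 𝓕⁻ f (c • x) := by
  simp only [Real.fourierInv_eq]
  have e : (fun ξ : Space d => Real.fourierChar (inner ℝ ξ x) • f (c⁻¹ • ξ))
      = fun ξ => (fun η : Space d => Real.fourierChar (inner ℝ η (c • x)) • f η) (c⁻¹ • ξ) := by
    funext ξ
    simp only [real_inner_smul_left, real_inner_smul_right]
    rw [mul_inv_cancel_left₀ hc.ne']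
  rw [e, Measure.integral_comp_inv_smul volume
    (fun η : Space d => Real.fourierChar (inner ℝ η (c • x)) • f η), finrank_euclideanSpace, Fintype.card_fin,
    abs_of_pos (by positivity), Complex.real_smul]

/-- `K` is the inverse Fourier transform of the low-frequency cut-off: its mean is the value of the
cut-off at zero, it is even because the cut-off is, and dyadic blocks become differences of
consecutive low-pass filters. -/
lemma IsLittlewoodPaley.exists_kernel {φ : Space d → ℝ} (hφ : IsLittlewoodPaley φ) :
    ∃ K : 𝓢(Space d, ℝ), ∫ x, K x = 1 ∧ (∀ x, K (-x) = K x) ∧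
      ∀ j x, dyadicKernel φ j x = dyadicDil K j x - dyadicDil K (j - 1) x := by
  obtain ⟨Φ, hΦ, hsupp, h0, heven, hdiff⟩ := hφ.exists_cutoff
  let Ψ : 𝓢(Space d, ℂ) := (hsupp.comp_left (g := Complex.ofReal) Complex.ofReal_zero).toSchwartzMap
    (Complex.ofRealCLM.contDiff.comp hΦ)
  have hΨ : ∀ ξ, Ψ ξ = (Φ ξ : ℂ) := fun ξ => rfl
  let K : 𝓢(Space d, ℝ) := SchwartzMap.postcompCLM Complex.reCLM (𝓕⁻ Ψ)
  have hK : ∀ x, K x = (𝓕⁻ (Ψ : Space d → ℂ) x).re := fun x => by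
    rw [← SchwartzMap.fourierInv_coe]; rfl
  refine ⟨K, ?_, fun x => ?_, fun j x => ?_⟩
  · have h1 : ∫ x, (𝓕⁻ Ψ : 𝓢(Space d, ℂ)) x = 1 := by
      have h := congrArg (fun f : 𝓢(Space d, ℂ) => f 0) 
        (FourierTransform.fourier_fourierInv_eq (F := 𝓢(Space d, ℂ)) Ψ)
      simp only [SchwartzMap.fourier_coe, Real.fourier_eq, inner_zero_right, neg_zero,
        AddChar.map_zero_eq_one, one_smul] at h
      rw [h, hΨ, h0, Complex.ofReal_one]
    have h2 := Complex.reCLM.integral_comp_comm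
      (SchwartzMap.integrable (μ := volume) (𝓕⁻ Ψ : 𝓢(Space d, ℂ)))
    rw [h1] at h2
    exact h2
  · rw [hK, hK]
    congr 1
    simp only [Real.fourierInv_eq]
    rw [← integral_neg_eq_self]
    simp only [inner_neg_neg, hΨ, heven]
  · have hc : (0 : ℝ) < 2 ^ j := by positivity
    have e : ∀ c : ℝ, 0 < c → ∀ x, (𝓕⁻ (fun ξ => Ψ (c⁻¹ • ξ)) x).re = c ^ d * K (c • x) := by
      intro c hc x
      rw [fourierInv_comp_smul Ψ hc, Complex.re_ofReal_mul, hK]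
    have hint : ∀ c : ℝ, c ≠ 0 → Integrable fun ξ => Ψ (c • ξ) := fun c hc =>
      Ψ.integrable.comp_smul hc
    have e1 : (fun ξ : Space d => (φ ((2 : ℝ) ^ (-j) • ξ) : ℂ))
        = fun ξ => Ψ (((2 : ℝ) ^ j)⁻¹ • ξ) - Ψ (((2 : ℝ) ^ (j - 1))⁻¹ • ξ) := by
      funext ξ
      rw [← hdiff, hΨ, hΨ, smul_smul, zpow_neg, zpow_sub_one₀ two_ne_zero, mul_inv, inv_inv,
        mul_comm, Complex.ofReal_sub]
    have i1 := (Real.fourierIntegral_convergent_iff (-x)).2 (hint ((2 : ℝ) ^ j)⁻¹ (by positivity))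
    have i2 := (Real.fourierIntegral_convergent_iff (-x)).2
      (hint ((2 : ℝ) ^ (j - 1))⁻¹ (by positivity))
    simp only [inner_neg_right, neg_neg] at i1 i2
    rw [dyadicKernel, e1, dyadicDil, dyadicDil, ← e _ hc, ← e _ (by positivity), ← Complex.sub_re]
    congr 1
    simp only [Real.fourierInv_eq, smul_sub]
    exact integral_sub i1 i2

/-! ### Dyadic dilations of a Schwartz kernel -/

lemma integral_dyadicDil_mul (K : Space d → ℝ) (j : ℤ) (w : Space d → ℝ) :
    ∫ x, dyadicDil K j x * w ((2 : ℝ) ^ j • x) = ∫ x, K x * w x := by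
  have hc : (0 : ℝ) < 2 ^ j := by positivity
  simp only [dyadicDil, mul_assoc]
  rw [integral_const_mul, Measure.integral_comp_smul volume (fun x => K x * w x),
    finrank_euclideanSpace, Fintype.card_fin, abs_of_pos (by positivity), smul_eq_mul,
    mul_inv_cancel_left₀ (by positivity)]

lemma integral_dyadicDil (K : Space d → ℝ) (j : ℤ) : ∫ x, dyadicDil K j x = ∫ x, K x := by
  simpa using integral_dyadicDil_mul K j (fun _ => 1)

lemma norm_dyadicDil (K : Space d → ℝ) (j : ℤ) (x : Space d) :
    ‖dyadicDil K j x‖ = dyadicDil (fun x => ‖K x‖) j x := by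
  rw [dyadicDil, norm_mul, Real.norm_of_nonneg (by positivity)]
  rfl

lemma integral_norm_dyadicDil (K : Space d → ℝ) (j : ℤ) :
    ∫ x, ‖dyadicDil K j x‖ = ∫ x, ‖K x‖ := by
  simp only [norm_dyadicDil, integral_dyadicDil]

lemma integral_norm_dyadicDil_mul_norm (K : Space d → ℝ) (j : ℤ) :
    ∫ x, ‖dyadicDil K j x‖ * ‖x‖ = (2 : ℝ) ^ (-j) * ∫ x, ‖K x‖ * ‖x‖ := by
  have hc : (0 : ℝ) < 2 ^ j := by positivity
  have h := integral_dyadicDil_mul (fun x => ‖K x‖) j (fun x => ‖x‖)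
  rw [← h, ← integral_const_mul]
  congr 1
  funext x
  rw [norm_dyadicDil, norm_smul, Real.norm_of_nonneg hc.le, zpow_neg]
  field_simp

lemma integrable_dyadicDil {K : Space d → ℝ} (hK : Integrable K) (j : ℤ) :
    Integrable (dyadicDil K j) :=
  (hK.comp_smul (R := (2 : ℝ) ^ j) (by positivity)).const_mul _

lemma integrable_dyadicDil_mul_norm (K : 𝓢(Space d, ℝ)) (j : ℤ) :
    Integrable (fun x => ‖dyadicDil K j x‖ * ‖x‖) := by
  have hc : (0 : ℝ) < 2 ^ j := by positivity
  have h : Integrable fun x => ‖K x‖ * ‖x‖ := by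
    simpa [mul_comm] using K.integrable_pow_mul volume 1
  refine ((h.comp_smul hc.ne').const_mul (((2 : ℝ) ^ j) ^ d * ((2 : ℝ) ^ j)⁻¹)).congr
    (ae_of_all _ fun x => ?_)
  simp only [dyadicDil, norm_mul, norm_pow, norm_smul, Real.norm_of_nonneg hc.le]
  field_simp

lemma dyadicDil_neg {K : Space d → ℝ} (hK : ∀ x, K (-x) = K x) (j : ℤ) (x : Space d) :
    dyadicDil K j (-x) = dyadicDil K j x := by
  rw [dyadicDil, smul_neg, hK]; rfl

lemma norm_toLOne_dyadicDil {K : Space d → ℝ} (hK : Integrable K) (j : ℤ) :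
    ‖toLOne (dyadicDil K j)‖ = ∫ x, ‖K x‖ := by
  rw [toLOne_eq (integrable_dyadicDil hK j), norm_toL1_eq, integral_norm_dyadicDil]

/-- A low-pass filter at frequency `2^j` smooths at length `2^{-j}`, so its output is Lipschitz with
constant proportional to `2^j`. -/
lemma exists_lintegral_translate_dyadicDil_le (K : 𝓢(Space d, ℝ)) : ∃ C : ℝ, 0 ≤ C ∧
    ∀ (j : ℤ) (h : Space d), ∫⁻ x, ‖dyadicDil K j (x + h) - dyadicDil K j x‖ₑ
      ≤ ENNReal.ofReal (C * (2 : ℝ) ^ j * ‖h‖) := by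
  obtain ⟨C, hC, hb⟩ := lintegral_enorm_lineDeriv_le K
  refine ⟨C, hC, fun j h => ?_⟩
  have hc : (0 : ℝ) < 2 ^ j := by positivity
  have h1 := (lintegral_enorm_schwartz_translate_le K ((2 : ℝ) ^ j • h)).trans (hb _)
  have h2 := KernelBound.lintegral_enorm_dil_le hc 0
    (fun x => K (x + (2 : ℝ) ^ j • h) - K x) h1
  have e : ∀ x, dyadicDil K j (x + h) - dyadicDil K j x = ((2 : ℝ) ^ j) ^ (d + 0) *
      (K ((2 : ℝ) ^ j • x + (2 : ℝ) ^ j • h) - K ((2 : ℝ) ^ j • x)) := fun x => by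
    simp only [dyadicDil, smul_add, add_zero]; ring
  simp only [e]
  refine h2.trans_eq ?_
  rw [norm_smul, Real.norm_of_nonneg hc.le]
  congr 1; ring

/-! ### The bilinear operator -/

/-- The bilinear operator `e^{tΔ} P ∇·(v ⊗ w)` with values in bounded continuous functions. -/
def oseenOp (t : ℝ) (v w : LInfty d) : Space d →ᵇ Space d :=
  ∑ i, ∑ j, ∑ k, conv (toLOne (oseenKernel t i j k)) (componentMul i j k v w)

lemma oseenOp_apply {t : ℝ} (ht : 0 < t) (v : LInfty d) (x : Space d) :
    oseenOp t v v x = oseenDiv t v x := by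
  obtain ⟨A, B, -, -, hAB⟩ := exists_kernelBound_oseenKernel d
  have h : ∀ i j k : Fin d, conv (toLOne (oseenKernel t i j k)) (componentMul i j k v v) x
      = (∫ y, oseenKernel t i j k (x - y) * (v y j * v y k)) • EuclideanSpace.single i (1 : ℝ) := by
    intro i j k
    rw [conv_toLOne_apply (hAB t ht i j k).integrable, ← integral_smul_const]
    refine integral_congr_ae ?_
    filter_upwards [coeFn_componentMul i j k v v] with y hy
    rw [hy, smul_smul]
  simp only [oseenOp, BoundedContinuousFunction.coe_sum, Finset.sum_apply, h]
  ext l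
  simp [oseenDiv, Finset.sum_apply, Pi.single_apply]

lemma oseenOp_self_sub_self (t : ℝ) (v w : LInfty d) :
    oseenOp t v v - oseenOp t w w = oseenOp t (v - w) v + oseenOp t w (v - w) := by
  simp only [oseenOp, ← Finset.sum_sub_distrib, ← Finset.sum_add_distrib]
  refine Finset.sum_congr rfl fun i _ => Finset.sum_congr rfl fun j _ =>
    Finset.sum_congr rfl fun k _ => ?_
  simp only [map_sub, sub_apply]
  abel

lemma exists_norm_oseenOp_le (d : ℕ) : ∃ C : ℝ, 0 ≤ C ∧ ∀ (t : ℝ), 0 < t → ∀ v w : LInfty d,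
    ‖oseenOp t v w‖ ≤ C * (√t)⁻¹ * (‖v‖ * ‖w‖) := by
  obtain ⟨A, B, hA, hB, hAB⟩ := exists_kernelBound_oseenKernel d
  refine ⟨d * (d * (d * A)), by positivity, fun t ht v w => ?_⟩
  have h : ∀ i j k : Fin d, ‖conv (toLOne (oseenKernel t i j k)) (componentMul i j k v w)‖
      ≤ A * (√t)⁻¹ * (‖v‖ * ‖w‖) := fun i j k =>
    (norm_conv_le _ _).trans (mul_le_mul ((hAB t ht i j k).norm_toLOne_le (by positivity))
      (norm_componentMul_le i j k v w) (norm_nonneg _) (by positivity))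
  calc ‖oseenOp t v w‖ ≤ ∑ _i : Fin d, ∑ _j : Fin d, ∑ _k : Fin d, A * (√t)⁻¹ * (‖v‖ * ‖w‖) := by
        refine norm_sum_le_of_le _ fun i _ => norm_sum_le_of_le _ fun j _ =>
          norm_sum_le_of_le _ fun k _ => h i j k
    _ = _ := by
        simp only [Finset.sum_const, Finset.card_univ, Fintype.card_fin, nsmul_eq_mul]
        ring

lemma continuousOn_oseenOp :
    ContinuousOn (fun p : ℝ × LInfty d => oseenOp p.1 p.2 p.2) (Ioi 0 ×ˢ univ) := by
  unfold oseenOp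
  refine continuousOn_finsetSum _ fun i _ => continuousOn_finsetSum _ fun j _ =>
    continuousOn_finsetSum _ fun k _ => ?_
  have h1 : ContinuousOn (fun p : ℝ × LInfty d => conv (toLOne (oseenKernel p.1 i j k)))
      (Ioi 0 ×ˢ univ) :=
    conv.continuous.comp_continuousOn ((continuousOn_toLOne_oseenKernel i j k).comp
      continuousOn_fst fun p hp => hp.1)
  have h2 : Continuous (fun p : ℝ × LInfty d => componentMul i j k p.2 p.2) :=
    ((componentMul i j k).continuous.comp continuous_snd).clm_apply continuous_snd
  exact h1.clm_apply h2.continuousOn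

/-! ### Second differences -/

/-- The second difference `w(x+h) + w(x-h) - 2w(x)` as a continuous linear functional of `w`. -/
def secDiffAt (h x : Space d) : (Space d →ᵇ Space d) →L[ℝ] Space d :=
  evalAt (x + h) + evalAt (x - h) - (2 : ℝ) • evalAt x

lemma secDiffAt_apply (h x : Space d) (w : Space d →ᵇ Space d) :
    secDiffAt h x w = w (x + h) + w (x - h) - (2 : ℝ) • w x := rfl

lemma norm_integral_smul_le {k : Space d → ℝ} {a : ℝ} (ha : 0 ≤ a)
    (hk : ∫⁻ x, ‖k x‖ₑ ≤ ENNReal.ofReal a) (f : LInfty d) (x : Space d) :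
    ‖∫ y, k (x - y) • f y‖ ≤ a * ‖f‖ := by
  have h : ‖∫ y, k (x - y) • f y‖ₑ ≤ ENNReal.ofReal (a * ‖f‖) := by
    calc ‖∫ y, k (x - y) • f y‖ₑ ≤ ∫⁻ y, ‖k (x - y) • f y‖ₑ := enorm_integral_le_lintegral_enorm _
      _ ≤ ∫⁻ y, ‖k (x - y)‖ₑ * ENNReal.ofReal ‖f‖ := by
          refine lintegral_mono_ae ?_
          filter_upwards [ae_norm_le f] with y hy
          rw [enorm_smul]
          gcongr
          rw [← ofReal_norm]
          exact ENNReal.ofReal_le_ofReal hy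
      _ = (∫⁻ y, ‖k y‖ₑ) * ENNReal.ofReal ‖f‖ := by
          rw [lintegral_mul_const' _ _ ENNReal.ofReal_ne_top,
            lintegral_sub_left_eq_self (fun y => ‖k y‖ₑ)]
      _ ≤ ENNReal.ofReal a * ENNReal.ofReal ‖f‖ := by gcongr
      _ = _ := (ENNReal.ofReal_mul ha).symm
  rw [← ofReal_norm] at h
  exact (ENNReal.ofReal_le_ofReal_iff (by positivity)).1 h

lemma integrable_kernel_smul {k : Space d → ℝ} (hk : Integrable k) (f : LInfty d) (x : Space d) :
    Integrable fun y => k (x - y) • f y :=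
  (hk.comp_sub_left x).smul_bdd ‖f‖ (Lp.stronglyMeasurable f).aestronglyMeasurable (ae_norm_le f)

/-- Second differences commute with convolution and are taken on the kernel, so no regularity of `f`
enters. -/
lemma norm_secDiffAt_conv_le {k : Space d → ℝ} {A B : ℝ} (hk : KernelBound k A B) (hA : 0 ≤ A)
    (hB : 0 ≤ B) (f : LInfty d) (h x : Space d) :
    ‖secDiffAt h x (conv (toLOne k) f)‖ ≤ min (4 * A) (B * ‖h‖ ^ 2) * ‖f‖ := by
  have hi := hk.integrable
  have e : secDiffAt h x (conv (toLOne k) f) = ∫ y, secDiff h k (x - y) • f y := by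
    have i1 := integrable_kernel_smul hi f (x + h)
    have i2 := integrable_kernel_smul hi f (x - h)
    have i3 := integrable_kernel_smul hi f x
    rw [secDiffAt_apply, conv_toLOne_apply hi, conv_toLOne_apply hi, conv_toLOne_apply hi,
      ← integral_smul, ← integral_add i1 i2,
      ← integral_sub (f := fun y => k (x + h - y) • f y + k (x - h - y) • f y) 
        (g := fun y => (2 : ℝ) • k (x - y) • f y) (i1.add i2) (i3.smul (2 : ℝ))]
    congr 1
    funext y
    have e1 : x - y + h = x + h - y := by abel
    have e2 : x - y - h = x - h - y := by abel
    simp only [secDiff, e1, e2, smul_smul, ← add_smul, ← sub_smul]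
  rw [e]
  exact norm_integral_smul_le (le_min (by positivity) (by positivity)) (hk.secDiff_le_min h) f x

lemma exists_norm_secDiffAt_oseenOp_le (d : ℕ) : ∃ C : ℝ, 0 ≤ C ∧ ∀ (t : ℝ), 0 < t →
    ∀ (v : LInfty d) (h x : Space d), ‖secDiffAt h x (oseenOp t v v)‖
      ≤ C * min (√t)⁻¹ (‖h‖ ^ 2 * (√t)⁻¹ ^ 3) * ‖v‖ ^ 2 := by
  obtain ⟨A, B, hA, hB, hAB⟩ := exists_kernelBound_oseenKernel d
  refine ⟨d * (d * (d * (4 * A + B))), by positivity, fun t ht v h x => ?_⟩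
  set m := min (√t)⁻¹ (‖h‖ ^ 2 * (√t)⁻¹ ^ 3) with hm
  have hm0 : 0 ≤ m := by positivity
  have hb : ∀ i j k : Fin d,
      ‖secDiffAt h x (conv (toLOne (oseenKernel t i j k)) (componentMul i j k v v))‖
      ≤ (4 * A + B) * m * ‖v‖ ^ 2 := fun i j k => by
    refine (norm_secDiffAt_conv_le (hAB t ht i j k) (by positivity) (by positivity) _ h x).trans ?_
    rw [sq ‖v‖]
    refine mul_le_mul ?_ (norm_componentMul_le i j k v v) (norm_nonneg _) (by positivity)
    rcases le_total (√t)⁻¹ (‖h‖ ^ 2 * (√t)⁻¹ ^ 3) with hc | hc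
    · rw [hm, min_eq_left hc]
      refine (min_le_left _ _).trans ?_
      have : 0 ≤ B * (√t)⁻¹ := by positivity
      linarith
    · rw [hm, min_eq_right hc]
      refine (min_le_right _ _).trans ?_
      have : 0 ≤ A * (‖h‖ ^ 2 * (√t)⁻¹ ^ 3) := by positivity
      linarith
  calc ‖secDiffAt h x (oseenOp t v v)‖
      ≤ ∑ _i : Fin d, ∑ _j : Fin d, ∑ _k : Fin d, (4 * A + B) * m * ‖v‖ ^ 2 := by
        simp only [oseenOp, map_sum]
        refine norm_sum_le_of_le _ fun i _ => norm_sum_le_of_le _ fun j _ =>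
          norm_sum_le_of_le _ fun k _ => hb i j k
    _ = _ := by
        simp only [Finset.sum_const, Finset.card_univ, Fintype.card_fin, nsmul_eq_mul]
        ring

/-! ### The Duhamel integral -/

lemma lintegral_inv_sqrt_Ioc {a : ℝ} (ha : 0 ≤ a) :
    ∫⁻ r in Ioc 0 a, ENNReal.ofReal (√r)⁻¹ = ENNReal.ofReal (2 * √a) := by
  have h1 : ∀ r ∈ Ioc 0 a, ENNReal.ofReal (√r)⁻¹ = ENNReal.ofReal (r ^ (-(1 / 2 : ℝ))) :=
    fun r hr => by rw [Real.sqrt_eq_rpow, Real.rpow_neg hr.1.le]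
  have hi : IntegrableOn (fun r : ℝ => r ^ (-(1 / 2 : ℝ))) (Ioc 0 a) :=
    (intervalIntegrable_iff_integrableOn_Ioc_of_le ha).1
      (intervalIntegral.intervalIntegrable_rpow' (by norm_num))
  rw [setLIntegral_congr_fun measurableSet_Ioc h1, ← ofReal_integral_eq_lintegral_ofReal hi
    ((ae_restrict_mem measurableSet_Ioc).mono fun r hr => Real.rpow_nonneg hr.1.le _),
    ← intervalIntegral.integral_of_le ha, integral_rpow (Or.inl (by norm_num))]
  congr 1
  rw [Real.sqrt_eq_rpow]
  norm_num
  ring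

lemma integrableOn_inv_sqrt (a : ℝ) : IntegrableOn (fun r : ℝ => (√r)⁻¹) (Ioc 0 a) := by
  rcases le_total 0 a with ha | ha
  · refine ⟨by fun_prop, ?_⟩
    have e : ∀ r : ℝ, ‖(√r)⁻¹‖ₑ = ENNReal.ofReal (√r)⁻¹ := fun r =>
      Real.enorm_of_nonneg (by positivity)
    rw [HasFiniteIntegral]
    simp only [e, lintegral_inv_sqrt_Ioc ha]
    exact ENNReal.ofReal_lt_top
  · rw [Ioc_eq_empty (not_lt.2 ha)]; exact integrableOn_empty

/-- In the Duhamel integral the endpoint `r = t` involves the value `u 0`, which the equation leaves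
arbitrary; it is a null set and is discarded. -/
lemma restrict_Ioc_eq_restrict_Ioo (a b : ℝ) :
    (volume : Measure ℝ).restrict (Ioc a b) = volume.restrict (Ioo a b) :=
  (Measure.restrict_congr_set Ioo_ae_eq_Ioc).symm

/-- The Duhamel term `∫_0^t e^{(t-s)Δ} P ∇·(u ⊗ u)(s) ds`, written with `r = t - s`. -/
def duhamel (u : ℝ → LInfty d) (t : ℝ) : Space d →ᵇ Space d :=
  ∫ r in Ioc 0 t, oseenOp r (u (t - r)) (u (t - r))

lemma aestronglyMeasurable_oseenOp {u : ℝ → LInfty d} {t : ℝ} (hu : ContinuousOn u (Ioo 0 t)) :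
    AEStronglyMeasurable (fun r => oseenOp r (u (t - r)) (u (t - r)))
      (volume.restrict (Ioc 0 t)) := by
  rw [restrict_Ioc_eq_restrict_Ioo]
  refine ContinuousOn.aestronglyMeasurable ?_ measurableSet_Ioo
  refine continuousOn_oseenOp.comp (f := fun r => (r, u (t - r))) ?_ fun r hr => ⟨hr.1, mem_univ _⟩
  refine continuousOn_id.prodMk (hu.comp (by fun_prop) fun r hr => ?_)
  exact ⟨sub_pos.2 hr.2, sub_lt_self _ hr.1⟩

lemma integrableOn_oseenOp {u : ℝ → LInfty d} {t M : ℝ} (hu : ContinuousOn u (Ioo 0 t))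
    (hM : ∀ s ∈ Ioo 0 t, ‖u s‖ ≤ M) :
    IntegrableOn (fun r => oseenOp r (u (t - r)) (u (t - r))) (Ioc 0 t) := by
  obtain ⟨C, hC, hb⟩ := exists_norm_oseenOp_le d
  refine (((integrableOn_inv_sqrt t).const_mul C).mul_const (M * M)).mono'
    (aestronglyMeasurable_oseenOp hu) ?_
  rw [restrict_Ioc_eq_restrict_Ioo]
  filter_upwards [ae_restrict_mem measurableSet_Ioo] with r hr
  have h := hM (t - r) ⟨sub_pos.2 hr.2, sub_lt_self _ hr.1⟩
  refine (hb r hr.1 _ _).trans ?_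
  have h0 : 0 ≤ M := (norm_nonneg _).trans h
  gcongr

/-- Evaluation at a point is continuous and linear, so it passes through the Bochner integral. This
identifies the pointwise integral in the definition of a strong solution with the Banach-valued one
used for estimates. -/
lemma duhamel_apply {u : ℝ → LInfty d} {t M : ℝ} (ht : 0 ≤ t) (hu : ContinuousOn u (Ioo 0 t))
    (hM : ∀ s ∈ Ioo 0 t, ‖u s‖ ≤ M) (x : Space d) :
    duhamel u t x = ∫ s in (0 : ℝ)..t, oseenDiv (t - s) (u s) x := by
  have h := (evalAt x).integral_comp_comm (integrableOn_oseenOp hu hM)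
  rw [duhamel, ← evalAt_apply, ← h]
  have h2 := intervalIntegral.integral_comp_sub_left (a := 0) (b := t)
    (fun r => oseenDiv r (u (t - r)) x) t
  simp only [sub_self, sub_zero, sub_sub_cancel] at h2
  rw [h2, intervalIntegral.integral_of_le ht]
  refine setIntegral_congr_fun measurableSet_Ioc fun r hr => ?_
  exact oseenOp_apply hr.1 _ _

lemma norm_le_of_enorm_le {E : Type*} [NormedAddCommGroup E] {y : E} {a : ℝ} (ha : 0 ≤ a)
    (h : ‖y‖ₑ ≤ ENNReal.ofReal a) : ‖y‖ ≤ a := by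
  rw [← ofReal_norm] at h
  exact (ENNReal.ofReal_le_ofReal_iff ha).1 h

lemma exists_norm_duhamel_le (d : ℕ) : ∃ C : ℝ, 0 ≤ C ∧ ∀ (u : ℝ → LInfty d) (t M : ℝ),
    (∀ s ∈ Ioo 0 t, ‖u s‖ ≤ M) → ‖duhamel u t‖ ≤ C * M ^ 2 * √t := by
  obtain ⟨C, hC, hb⟩ := exists_norm_oseenOp_le d
  refine ⟨2 * C, by positivity, fun u t M hM => ?_⟩
  refine norm_le_of_enorm_le (by positivity) ?_
  rcases le_or_gt t 0 with ht | ht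
  · rw [duhamel, Ioc_eq_empty (not_lt.2 ht), Measure.restrict_empty, integral_zero_measure,
      ← ofReal_norm, norm_zero, ENNReal.ofReal_zero]
    exact zero_le
  calc ‖duhamel u t‖ₑ ≤ ∫⁻ r in Ioc 0 t, ‖oseenOp r (u (t - r)) (u (t - r))‖ₑ :=
        enorm_integral_le_lintegral_enorm _
    _ ≤ ∫⁻ r in Ioc 0 t, ENNReal.ofReal (C * M ^ 2) * ENNReal.ofReal (√r)⁻¹ := by
        rw [restrict_Ioc_eq_restrict_Ioo]
        refine setLIntegral_mono' measurableSet_Ioo fun r hr => ?_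
        rw [← ofReal_norm, ← ENNReal.ofReal_mul (by positivity)]
        refine ENNReal.ofReal_le_ofReal ((hb r hr.1 _ _).trans ?_)
        have h := hM (t - r) ⟨sub_pos.2 hr.2, sub_lt_self _ hr.1⟩
        have h0 : 0 ≤ M := (norm_nonneg _).trans h
        calc C * (√r)⁻¹ * (‖u (t - r)‖ * ‖u (t - r)‖) ≤ C * (√r)⁻¹ * (M * M) := by gcongr
          _ = _ := by ring
    _ = ENNReal.ofReal (2 * C * M ^ 2 * √t) := by
        rw [lintegral_const_mul' _ _ ENNReal.ofReal_ne_top, lintegral_inv_sqrt_Ioc ht.le,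
          ← ENNReal.ofReal_mul (by positivity)]
        congr 1; ring

/-- Splitting at `r = a²`, each half contributes at most `2a`. This is why second differences are
used: first differences would give `min (r^{-1/2}) (a r⁻¹)`, whose integral diverges logarithmically
at infinity. -/
lemma lintegral_min_inv_sqrt_le (a : ℝ) (ha : 0 ≤ a) :
    ∫⁻ r in Ioi 0, ENNReal.ofReal (min (√r)⁻¹ (a ^ 2 * (√r)⁻¹ ^ 3)) ≤ ENNReal.ofReal (4 * a) := by
  rcases ha.eq_or_lt with rfl | ha
  · simp
  rw [← Ioc_union_Ioi_eq_Ioi (sq_nonneg a)]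
  refine (lintegral_union_le _ _ _).trans ?_
  have h1 : ∫⁻ r in Ioc 0 (a ^ 2), ENNReal.ofReal (min (√r)⁻¹ (a ^ 2 * (√r)⁻¹ ^ 3))
      ≤ ENNReal.ofReal (2 * a) := by
    refine (lintegral_mono fun r => ENNReal.ofReal_le_ofReal (min_le_left _ _)).trans_eq ?_
    rw [lintegral_inv_sqrt_Ioc (sq_nonneg a), Real.sqrt_sq ha.le]
  have h2 : ∫⁻ r in Ioi (a ^ 2), ENNReal.ofReal (min (√r)⁻¹ (a ^ 2 * (√r)⁻¹ ^ 3))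
      ≤ ENNReal.ofReal (2 * a) := by
    refine (lintegral_mono fun r => ENNReal.ofReal_le_ofReal (min_le_right _ _)).trans ?_
    simp only [ENNReal.ofReal_mul (sq_nonneg a)]
    rw [lintegral_const_mul' _ _ ENNReal.ofReal_ne_top]
    refine (mul_le_mul_right (lintegral_inv_sqrt_pow_le (by positivity) 0) _).trans_eq ?_
    rw [← ENNReal.ofReal_mul (sq_nonneg a), Real.sqrt_sq ha.le]
    congr 1
    rw [zero_add, pow_one]
    field_simp
  refine (add_le_add h1 h2).trans_eq ?_
  rw [← ENNReal.ofReal_add (by positivity) (by positivity)]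
  congr 1; ring

/-- A Zygmund-type gain of one derivative, with a constant independent of `t`: the time integral of
the kernel bound converges over all of `(0, ∞)`. -/
lemma exists_norm_secDiffAt_duhamel_le (d : ℕ) : ∃ C : ℝ, 0 < C ∧
    ∀ (u : ℝ → LInfty d) (t M : ℝ), ContinuousOn u (Ioo 0 t) → (∀ s ∈ Ioo 0 t, ‖u s‖ ≤ M) →
      ∀ h x, ‖secDiffAt h x (duhamel u t)‖ ≤ C * M ^ 2 * ‖h‖ := by
  obtain ⟨C, hC, hb⟩ := exists_norm_secDiffAt_oseenOp_le d
  refine ⟨4 * C + 1, by positivity, fun u t M hu hM h x => ?_⟩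
  have e : secDiffAt h x (duhamel u t)
      = ∫ r in Ioc 0 t, secDiffAt h x (oseenOp r (u (t - r)) (u (t - r))) :=
    ((secDiffAt h x).integral_comp_comm (integrableOn_oseenOp hu hM)).symm
  refine (norm_le_of_enorm_le (a := 4 * C * M ^ 2 * ‖h‖) (by positivity) ?_).trans (by
    have : 0 ≤ M ^ 2 * ‖h‖ := by positivity
    nlinarith)
  rw [e]
  calc ‖∫ r in Ioc 0 t, secDiffAt h x (oseenOp r (u (t - r)) (u (t - r)))‖ₑ
      ≤ ∫⁻ r in Ioc 0 t, ‖secDiffAt h x (oseenOp r (u (t - r)) (u (t - r)))‖ₑ :=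
        enorm_integral_le_lintegral_enorm _
    _ ≤ ∫⁻ r in Ioo 0 t, ENNReal.ofReal (C * M ^ 2) *
          ENNReal.ofReal (min (√r)⁻¹ (‖h‖ ^ 2 * (√r)⁻¹ ^ 3)) := by
        rw [restrict_Ioc_eq_restrict_Ioo]
        refine setLIntegral_mono' measurableSet_Ioo fun r hr => ?_
        rw [← ofReal_norm, ← ENNReal.ofReal_mul (by positivity)]
        refine ENNReal.ofReal_le_ofReal ((hb r hr.1 _ h x).trans ?_)
        have hm := hM (t - r) ⟨sub_pos.2 hr.2, sub_lt_self _ hr.1⟩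
        rw [mul_right_comm]
        gcongr
    _ ≤ ∫⁻ r in Ioi 0, ENNReal.ofReal (C * M ^ 2) *
          ENNReal.ofReal (min (√r)⁻¹ (‖h‖ ^ 2 * (√r)⁻¹ ^ 3)) :=
        lintegral_mono_set Ioo_subset_Ioi_self
    _ ≤ ENNReal.ofReal (C * M ^ 2) * ENNReal.ofReal (4 * ‖h‖) := by
        rw [lintegral_const_mul' _ _ ENNReal.ofReal_ne_top]
        gcongr
        exact lintegral_min_inv_sqrt_le _ (norm_nonneg h)
    _ = _ := by
        rw [← ENNReal.ofReal_mul (by positivity)]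
        congr 1; ring

/-! ### Continuity and contraction properties of the Duhamel integral -/

lemma continuousOn_duhamel {u : ℝ → LInfty d} {T M : ℝ} (hu : ContinuousOn u (Ioo 0 T))
    (hM : ∀ s ∈ Ioo 0 T, ‖u s‖ ≤ M) : ContinuousOn (duhamel u) (Ioo 0 T) := by
  obtain ⟨C, hC, hb⟩ := exists_norm_oseenOp_le d
  have hsub : ∀ t ∈ Ioo 0 T, Ioo 0 t ⊆ Ioo 0 T := fun t ht => Ioo_subset_Ioo_right ht.2.le
  -- An indicator fixes the domain of integration, so that dominated convergence applies; the
  -- integrand is continuous in `t` at `t₀` for every `r ≠ t₀`.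
  have e : ∀ t ∈ Ioo 0 T, duhamel u t = ∫ r in Ioc 0 T,
      (Ioc 0 t).indicator (fun r => oseenOp r (u (t - r)) (u (t - r))) r := fun t ht => by
    rw [setIntegral_indicator measurableSet_Ioc,
      inter_eq_right.2 (Ioc_subset_Ioc_right ht.2.le), duhamel]
  refine ContinuousOn.congr ?_ e
  intro t₀ ht₀
  refine ContinuousAt.continuousWithinAt ?_
  have hnhds := Ioo_mem_nhds ht₀.1 ht₀.2
  refine continuousAt_of_dominated (bound := fun r => C * (√r)⁻¹ * (M * M)) ?_ ?_ ?_ ?_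
  · filter_upwards [hnhds] with t ht
    rw [aestronglyMeasurable_indicator_iff measurableSet_Ioc,
      Measure.restrict_restrict measurableSet_Ioc,
      inter_eq_left.2 (Ioc_subset_Ioc_right ht.2.le)]
    exact aestronglyMeasurable_oseenOp (hu.mono (hsub t ht))
  · filter_upwards [hnhds] with t ht
    have hne : ∀ᵐ r ∂(volume.restrict (Ioc 0 T)), r ≠ t :=
      ae_restrict_of_ae (Measure.ae_ne volume t)
    filter_upwards [ae_restrict_mem measurableSet_Ioc, hne] with r hr hrt
    have h0 : 0 ≤ M := (norm_nonneg _).trans (hM t ht)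
    by_cases hc : r ∈ Ioc 0 t
    · rw [indicator_of_mem hc]
      have h := hM (t - r) (hsub t ht ⟨sub_pos.2 (lt_of_le_of_ne hc.2 hrt), sub_lt_self _ hr.1⟩)
      refine (hb r hr.1 _ _).trans ?_
      have := norm_nonneg (u (t - r))
      gcongr
    · rw [indicator_of_notMem hc, norm_zero]
      positivity
  · exact ((integrableOn_inv_sqrt T).const_mul C).mul_const (M * M)
  · have hne : ∀ᵐ r ∂(volume.restrict (Ioc 0 T)), r ≠ t₀ :=
      ae_restrict_of_ae (Measure.ae_ne volume t₀)
    filter_upwards [ae_restrict_mem measurableSet_Ioc, hne] with r hr hrt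
    rcases lt_or_gt_of_ne hrt with hlt | hgt
    · have hmem : t₀ - r ∈ Ioo 0 T := ⟨sub_pos.2 hlt, by linarith [hr.1, ht₀.2]⟩
      have hcu : ContinuousAt (fun t => u (t - r)) t₀ :=
        ContinuousAt.comp (f := fun t => t - r) (hu.continuousAt (Ioo_mem_nhds hmem.1 hmem.2))
          (by fun_prop)
      have hc : ContinuousAt (fun t => oseenOp r (u (t - r)) (u (t - r))) t₀ := by
        have h1 : ContinuousAt (fun p : ℝ × LInfty d => oseenOp p.1 p.2 p.2) (r, u (t₀ - r)) :=
          continuousOn_oseenOp.continuousAt (prod_mem_nhds (Ioi_mem_nhds hr.1) univ_mem)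
        exact ContinuousAt.comp (f := fun t => (r, u (t - r))) h1 (continuousAt_const.prodMk hcu)
      refine hc.congr ?_
      filter_upwards [Ioi_mem_nhds hlt] with t ht
      rw [indicator_of_mem (show r ∈ Ioc 0 t from ⟨hr.1, le_of_lt ht⟩)]
    · refine (continuousAt_const (y := (0 : Space d →ᵇ Space d))).congr ?_
      filter_upwards [Iio_mem_nhds hgt] with t ht
      rw [indicator_of_notMem fun h => (not_lt.2 h.2) ht]

/-- Where the two paths agree the integrand vanishes, so only delays `r ≤ δ` contribute, and
integrating `r^{-1/2}` over them gives `2√δ`. This smallness drives the contraction for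
continuation. -/
lemma exists_norm_duhamel_sub_le (d : ℕ) : ∃ C : ℝ, 0 ≤ C ∧
    ∀ (v w : ℝ → LInfty d) (t₁ δ R D t : ℝ), 0 ≤ δ → t ≤ t₁ + δ → 0 ≤ D →
      ContinuousOn v (Ioo 0 t) → ContinuousOn w (Ioo 0 t) →
      (∀ s ∈ Ioo 0 t, ‖v s‖ ≤ R) → (∀ s ∈ Ioo 0 t, ‖w s‖ ≤ R) →
      (∀ s ∈ Ioo 0 t, s ≤ t₁ → v s = w s) → (∀ s ∈ Ioo 0 t, ‖v s - w s‖ ≤ D) →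
      ‖duhamel v t - duhamel w t‖ ≤ C * |R| * D * √δ := by
  obtain ⟨C, hC, hb⟩ := exists_norm_oseenOp_le d
  refine ⟨4 * C, by positivity, fun v w t₁ δ R D t hδ ht hD hv hw hvR hwR hvw hvwD => ?_⟩
  refine norm_le_of_enorm_le (by positivity) ?_
  rw [duhamel, duhamel, ← integral_sub (integrableOn_oseenOp hv hvR) (integrableOn_oseenOp hw hwR)]
  calc _ ≤ ∫⁻ r in Ioc 0 t, ‖oseenOp r (v (t - r)) (v (t - r))
          - oseenOp r (w (t - r)) (w (t - r))‖ₑ := enorm_integral_le_lintegral_enorm _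
    _ ≤ ∫⁻ r in Ioo 0 t, (Ioc 0 δ).indicator
          (fun r => ENNReal.ofReal (2 * C * |R| * D) * ENNReal.ofReal (√r)⁻¹) r := by
        rw [restrict_Ioc_eq_restrict_Ioo]
        refine setLIntegral_mono' measurableSet_Ioo fun r hr => ?_
        have hm : t - r ∈ Ioo 0 t := ⟨sub_pos.2 hr.2, sub_lt_self _ hr.1⟩
        by_cases hc : t - r ≤ t₁
        · rw [hvw _ hm hc, sub_self, ← ofReal_norm, norm_zero, ENNReal.ofReal_zero]
          exact zero_le
        · rw [indicator_of_mem (show r ∈ Ioc 0 δ from ⟨hr.1, by linarith⟩), ← ofReal_norm,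
            ← ENNReal.ofReal_mul (by positivity), oseenOp_self_sub_self]
          refine ENNReal.ofReal_le_ofReal ((norm_add_le _ _).trans
            ((add_le_add (hb r hr.1 _ _) (hb r hr.1 _ _)).trans ?_))
          have h1 := (hvR _ hm).trans (le_abs_self R)
          have h2 := (hwR _ hm).trans (le_abs_self R)
          have h3 := hvwD _ hm
          calc C * (√r)⁻¹ * (‖v (t - r) - w (t - r)‖ * ‖v (t - r)‖)
                + C * (√r)⁻¹ * (‖w (t - r)‖ * ‖v (t - r) - w (t - r)‖)
              ≤ C * (√r)⁻¹ * (D * |R|) + C * (√r)⁻¹ * (|R| * D) := by gcongr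
            _ = _ := by ring
    _ ≤ ∫⁻ r, (Ioc 0 δ).indicator
          (fun r => ENNReal.ofReal (2 * C * |R| * D) * ENNReal.ofReal (√r)⁻¹) r :=
        setLIntegral_le_lintegral _ _
    _ = ENNReal.ofReal (4 * C * |R| * D * √δ) := by
        rw [lintegral_indicator measurableSet_Ioc, lintegral_const_mul' _ _ ENNReal.ofReal_ne_top,
          lintegral_inv_sqrt_Ioc hδ, ← ENNReal.ofReal_mul (by positivity)]
        congr 1; ring

/-! ### High and low frequencies -/

/-- Convolution with `k` as an operator on bounded continuous functions. -/
def convOp (k : Space d → ℝ) : (Space d →ᵇ Space d) →L[ℝ] (Space d →ᵇ Space d) :=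
  (conv (toLOne k)).comp toLInfty

lemma convOp_apply (k : Space d → ℝ) (w : Space d →ᵇ Space d) :
    convOp k w = conv (toLOne k) (toLInfty w) := rfl

lemma convOp_apply_apply {k : Space d → ℝ} (hk : Integrable k) (w : Space d →ᵇ Space d)
    (x : Space d) : convOp k w x = ∫ h, k h • w (x - h) := by
  have e : ∫ y, k (x - y) • toLInfty w y = ∫ y, k (x - y) • w y := by
    refine integral_congr_ae ?_
    filter_upwards [coeFn_toLInfty w] with y hy
    rw [hy]
  rw [convOp_apply, conv_toLOne_apply hk, e, ← integral_sub_left_eq_self _ volume x]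
  simp only [sub_sub_cancel]

lemma norm_convOp_le {k : Space d → ℝ} (hk : Integrable k) (w : Space d →ᵇ Space d) :
    ‖convOp k w‖ ≤ (∫ x, ‖k x‖) * ‖w‖ := by
  refine (norm_conv_le _ _).trans ?_
  rw [toLOne_eq hk, norm_toL1_eq]
  gcongr
  exact norm_toLInfty_le w

lemma integrable_smul_bcf {k : Space d → ℝ} (hk : Integrable k) (w : Space d →ᵇ Space d)
    {g : Space d → Space d} (hg : Continuous g) : Integrable fun h => k h • w (g h) :=
  hk.smul_bdd ‖w‖ (w.continuous.comp hg).aestronglyMeasurable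
    (ae_of_all _ fun _ => w.norm_coe_le_norm _)

/-- A function whose second differences are Lipschitz is close to its low-frequency part. -/
lemma norm_sub_convOp_dyadicDil_le {K : 𝓢(Space d, ℝ)} (h1 : ∫ x, K x = 1)
    (heven : ∀ x, K (-x) = K x) {w : Space d →ᵇ Space d} {L : ℝ}
    (hL : ∀ h x, ‖secDiffAt h x w‖ ≤ L * ‖h‖) (j : ℤ) (x : Space d) :
    ‖w x - convOp (dyadicDil K j) w x‖ ≤ L * ((2 : ℝ) ^ (-j) * ∫ x, ‖K x‖ * ‖x‖) := by
  set k := dyadicDil K j with hk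
  have hki : Integrable k := integrable_dyadicDil K.integrable j
  have e1 : convOp k w x = ∫ h, k h • w (x - h) := convOp_apply_apply hki w x
  have e2 : convOp k w x = ∫ h, k h • w (x + h) := by
    rw [e1, ← integral_neg_eq_self]
    congr 1
    funext h
    rw [hk, dyadicDil_neg heven, sub_neg_eq_add]
  have e3 : w x = ∫ h, k h • w x := by
    rw [integral_smul_const, integral_dyadicDil, h1, one_smul]
  have i1 : Integrable fun h => k h • w (x - h) := integrable_smul_bcf hki w (by fun_prop)
  have i2 : Integrable fun h => k h • w (x + h) := integrable_smul_bcf hki w (by fun_prop)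
  have i3 : Integrable fun h => k h • w x := hki.smul_const _
  -- Averaging the formulas with `w (x - h)` and `w (x + h)`, equal by evenness of the kernel, turns
  -- the error into a mean of second differences; unit mass supplies the term `w x`.
  have e4 : (2 : ℝ) • (convOp k w x - w x) = ∫ h, k h • secDiffAt h x w := by
    have : (2 : ℝ) • (convOp k w x - w x)
        = (∫ h, k h • w (x + h)) + (∫ h, k h • w (x - h)) - (2 : ℝ) • ∫ h, k h • w x := by
      rw [← e1, ← e2, ← e3, two_smul, two_smul]; abel
    rw [this, ← integral_smul, ← integral_add i2 i1,
      ← integral_sub (f := fun h => k h • w (x + h) + k h • w (x - h))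
        (g := fun h => (2 : ℝ) • k h • w x) (i2.add i1) (i3.smul (2 : ℝ))]
    congr 1
    funext h
    rw [secDiffAt_apply, smul_sub, smul_add, smul_comm (2 : ℝ)]
  have e5 : ‖(2 : ℝ) • (convOp k w x - w x)‖ ≤ L * ((2 : ℝ) ^ (-j) * ∫ x, ‖K x‖ * ‖x‖) := by
    rw [e4, ← integral_norm_dyadicDil_mul_norm, ← integral_const_mul]
    refine norm_integral_le_of_norm_le ((integrable_dyadicDil_mul_norm K j).const_mul L)
      (ae_of_all _ fun h => ?_)
    rw [norm_smul, mul_left_comm]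
    gcongr
    exact hL h x
  rw [norm_smul, Real.norm_two] at e5
  rw [norm_sub_rev]
  linarith [norm_nonneg (convOp k w x - w x)]

/-- Associativity of convolution. -/
lemma convOp_conv_apply {a k : Space d → ℝ} (ha : Integrable a) (hk : Integrable k)
    (f : LInfty d) (x : Space d) :
    convOp a (conv (toLOne k) f) x = ∫ z, k z • conv (toLOne a) f (x - z) := by
  have hF : Integrable (fun p : Space d × Space d => (a (x - p.1) * k p.2) • f (p.1 - p.2))
      (volume.prod volume) := by
    have hq := quasiMeasurePreserving_sub_of_right_invariant (volume : Measure (Space d)) volume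
    exact ((ha.comp_sub_left x).mul_prod hk).smul_bdd ‖f‖
      ((Lp.aestronglyMeasurable f).comp_quasiMeasurePreserving hq) (hq.ae (ae_norm_le f))
  calc convOp a (conv (toLOne k) f) x
      = ∫ y, a (x - y) • conv (toLOne k) f y := by
        rw [convOp_apply_apply ha, ← integral_sub_left_eq_self _ volume x]
        simp only [sub_sub_cancel]
    _ = ∫ y, ∫ z, (a (x - y) * k z) • f (y - z) := by
        congr 1
        funext y
        rw [conv_toLOne_apply hk, ← integral_sub_left_eq_self _ volume y]
        simp only [sub_sub_cancel, mul_smul, integral_smul]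
    _ = ∫ z, ∫ y, (a (x - y) * k z) • f (y - z) := integral_integral_swap hF
    _ = _ := by
        congr 1
        funext z
        rw [conv_toLOne_apply ha, ← integral_add_right_eq_self _ z]
        simp only [add_sub_cancel_right, mul_comm _ (k z), mul_smul, integral_smul, sub_sub,
          add_comm z]

/-- By associativity the filter can act on `f` first. The filtered `f` has Lipschitz constant of
order `2^j`, and since `k` has mean zero only its increments matter; dominated convergence with
majorant a multiple of `|k|` concludes, uniformly in `x`. -/
lemma tendsto_convOp_conv {K : 𝓢(Space d, ℝ)} {k : Space d → ℝ} (hk : Integrable k)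
    (h0 : ∫ x, k x = 0) (f : LInfty d) :
    Tendsto (fun j : ℤ => convOp (dyadicDil K j) (conv (toLOne k) f)) atBot (𝓝 0) := by
  obtain ⟨C, hC, hCb⟩ := exists_lintegral_translate_dyadicDil_le K
  set m := ∫ x, ‖K x‖ with hm
  have hm0 : 0 ≤ m := integral_nonneg fun _ => norm_nonneg _
  have hKi := fun j : ℤ => integrable_dyadicDil K.integrable j
  let g : ℤ → Space d → ℝ := fun j z => ‖k z‖ * (min (2 * m) (C * (2 : ℝ) ^ j * ‖z‖) * ‖f‖)
  have hpt : ∀ (j : ℤ) (x z : Space d),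
      ‖conv (toLOne (dyadicDil K j)) f (x - z) - conv (toLOne (dyadicDil K j)) f x‖
        ≤ min (2 * m) (C * (2 : ℝ) ^ j * ‖z‖) * ‖f‖ := by
    intro j x z
    rw [min_mul_of_nonneg _ _ (norm_nonneg f)]
    refine le_min ?_ ?_
    · have hb : ∀ y, ‖conv (toLOne (dyadicDil K j)) f y‖ ≤ m * ‖f‖ := fun y =>
        (BoundedContinuousFunction.norm_coe_le_norm _ y).trans
          ((norm_conv_le _ _).trans_eq (by rw [norm_toLOne_dyadicDil K.integrable]))
      refine (norm_sub_le _ _).trans ?_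
      linarith [hb (x - z), hb x]
    · rw [conv_toLOne_apply (hKi j), conv_toLOne_apply (hKi j),
        ← integral_sub (integrable_kernel_smul (hKi j) f _) (integrable_kernel_smul (hKi j) f _)]
      have hb := hCb j (-z)
      rw [norm_neg] at hb
      refine le_trans (le_of_eq ?_) (norm_integral_smul_le (by positivity) hb f x)
      congr 2
      funext y
      rw [← sub_smul, sub_right_comm, sub_eq_add_neg (x - y) z]
  have hg0 : ∀ j z, 0 ≤ g j z := fun j z => by positivity
  have hgm : ∀ j, AEStronglyMeasurable (g j) volume := fun j => by
    refine hk.1.norm.mul (Continuous.aestronglyMeasurable ?_)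
    fun_prop
  have hgb : ∀ j z, ‖g j z‖ ≤ ‖k z‖ * (2 * m * ‖f‖) := fun j z => by
    rw [Real.norm_of_nonneg (hg0 j z)]
    simp only [g]
    gcongr
    exact min_le_left _ _
  have hgi : ∀ j, Integrable (g j) := fun j =>
    (hk.norm.mul_const (2 * m * ‖f‖)).mono' (hgm j) (ae_of_all _ (hgb j))
  have hlim : Tendsto (fun j => ∫ z, g j z) atBot (𝓝 0) := by
    have := tendsto_integral_filter_of_dominated_convergence (l := (atBot : Filter ℤ))
      (F := g) (f := fun _ => 0) (fun z => ‖k z‖ * (2 * m * ‖f‖)) (Eventually.of_forall hgm)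
      (Eventually.of_forall fun j => ae_of_all _ (hgb j)) (hk.norm.mul_const _)
      (ae_of_all _ fun z => ?_)
    · simpa using this
    · have h2 : Tendsto (fun j : ℤ => (2 : ℝ) ^ j) atBot (𝓝 0) := by
        have hn : Tendsto Int.toNat atTop atTop :=
          tendsto_atTop_atTop.2 fun b => ⟨b, fun a ha => by omega⟩
        have h := (tendsto_pow_atTop_nhds_zero_of_lt_one (r := (2 : ℝ)⁻¹) (by norm_num)
          (by norm_num)).comp (hn.comp tendsto_neg_atBot_atTop)
        refine h.congr' ?_
        filter_upwards [eventually_le_atBot 0] with j hj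
        simp only [Function.comp]
        rw [inv_pow, ← zpow_natCast, ← zpow_neg]
        congr 1
        omega
      have h3 : Tendsto (fun j : ℤ => ‖k z‖ * (min (2 * m) (C * (2 : ℝ) ^ j * ‖z‖) * ‖f‖)) atBot
          (𝓝 (‖k z‖ * (min (2 * m) (C * 0 * ‖z‖) * ‖f‖))) :=
        ((tendsto_const_nhds.min ((h2.const_mul C).mul_const _)).mul_const _).const_mul _
      have h4 : min (2 * m) (C * 0 * ‖z‖) = 0 := by
        rw [mul_zero, zero_mul]
        exact min_eq_right (by positivity)
      rw [h4, zero_mul, mul_zero] at h3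
      exact h3
  refine squeeze_zero_norm (fun j => ?_) hlim
  rw [BoundedContinuousFunction.norm_le (integral_nonneg (hg0 j))]
  intro x
  have i1 : Integrable fun z => k z • conv (toLOne (dyadicDil K j)) f (x - z) :=
    integrable_smul_bcf hk _ (by fun_prop)
  have e : convOp (dyadicDil K j) (conv (toLOne k) f) x
      = ∫ z, k z • (conv (toLOne (dyadicDil K j)) f (x - z)
          - conv (toLOne (dyadicDil K j)) f x) := by
    simp only [smul_sub]
    rw [integral_sub i1 (hk.smul_const _), integral_smul_const, h0, zero_smul, sub_zero,
      convOp_conv_apply (hKi j) hk]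
  rw [e]
  refine norm_integral_le_of_norm_le (hgi j) (ae_of_all _ fun z => ?_)
  rw [norm_smul]
  exact mul_le_mul_of_nonneg_left (hpt j x z) (norm_nonneg _)

lemma tendsto_convOp_oseenOp (K : 𝓢(Space d, ℝ)) {t : ℝ} (ht : 0 < t) (v w : LInfty d) :
    Tendsto (fun j : ℤ => convOp (dyadicDil K j) (oseenOp t v w)) atBot (𝓝 0) := by
  obtain ⟨A, B, -, -, hAB⟩ := exists_kernelBound_oseenKernel d
  simp only [oseenOp, map_sum]
  have h : ∀ i j k : Fin d, Tendsto (fun l : ℤ => convOp (dyadicDil K l)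
      (conv (toLOne (oseenKernel t i j k)) (componentMul i j k v w))) atBot (𝓝 0) :=
    fun i j k => tendsto_convOp_conv (hAB t ht i j k).integrable (integral_oseenKernel ht i j k) _
  have := tendsto_finsetSum Finset.univ fun i _ => tendsto_finsetSum Finset.univ fun j _ =>
    tendsto_finsetSum Finset.univ fun k _ => h i j k
  simpa using this

lemma tendsto_convOp_duhamel (K : 𝓢(Space d, ℝ)) {u : ℝ → LInfty d} {t M : ℝ}
    (hu : ContinuousOn u (Ioo 0 t)) (hM : ∀ s ∈ Ioo 0 t, ‖u s‖ ≤ M) :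
    Tendsto (fun j : ℤ => convOp (dyadicDil K j) (duhamel u t)) atBot (𝓝 0) := by
  obtain ⟨C, hC, hb⟩ := exists_norm_oseenOp_le d
  have hint := integrableOn_oseenOp hu hM
  have e : ∀ j : ℤ, convOp (dyadicDil K j) (duhamel u t)
      = ∫ r in Ioc 0 t, convOp (dyadicDil K j) (oseenOp r (u (t - r)) (u (t - r))) := fun j =>
    ((convOp (dyadicDil K j)).integral_comp_comm hint).symm
  simp only [e]
  have := tendsto_integral_filter_of_dominated_convergence (l := (atBot : Filter ℤ))
    (μ := volume.restrict (Ioc 0 t))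
    (F := fun j r => convOp (dyadicDil K j) (oseenOp r (u (t - r)) (u (t - r))))
    (f := fun _ => (0 : Space d →ᵇ Space d))
    (fun r => (∫ x, ‖K x‖) * ‖oseenOp r (u (t - r)) (u (t - r))‖)
    (Eventually.of_forall fun j =>
      (convOp (dyadicDil K j)).continuous.comp_aestronglyMeasurable hint.1)
    (Eventually.of_forall fun j => ae_of_all _ fun r => ?_) (hint.norm.const_mul _) ?_
  · simpa using this
  · refine (norm_convOp_le (integrable_dyadicDil K.integrable j) _).trans_eq ?_
    rw [integral_norm_dyadicDil]
  · filter_upwards [ae_restrict_mem measurableSet_Ioc] with r hr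
    exact tendsto_convOp_oseenOp K hr.1 _ _

/-! ### Dyadic blocks -/

lemma dyadicBlock_eq {φ : Space d → ℝ} {K : 𝓢(Space d, ℝ)}
    (hK : ∀ j x, dyadicKernel φ j x = dyadicDil K j x - dyadicDil K (j - 1) x) (j : ℤ)
    (f : LInfty d) (x : Space d) :
    dyadicBlock φ j f x = conv (toLOne (dyadicDil K j)) f x
      - conv (toLOne (dyadicDil K (j - 1))) f x := by
  have hKi := fun j : ℤ => integrable_dyadicDil K.integrable j
  rw [dyadicBlock, conv_toLOne_apply (hKi j), conv_toLOne_apply (hKi _),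
    ← integral_sub (integrable_kernel_smul (hKi j) f _) (integrable_kernel_smul (hKi _) f _)]
  simp only [hK, sub_smul]

lemma ae_norm_dyadicBlock_le {φ : Space d → ℝ} {f : Space d → Space d} {ε : ℝ} (hε : 0 ≤ ε)
    (h : besovNorm φ f ≤ ENNReal.ofReal ε) :
    ∀ᵐ x, ∀ j : ℤ, ‖dyadicBlock φ j f x‖ ≤ (2 : ℝ) ^ j * ε := by
  rw [ae_all_iff]
  intro j
  have hj : ENNReal.ofReal ((2 : ℝ) ^ (-j)) * eLpNorm (dyadicBlock φ j f) (⊤ : ℝ≥0∞) volume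
      ≤ ENNReal.ofReal ε := (le_iSup _ j).trans h
  rw [eLpNorm_exponent_top] at hj
  filter_upwards [ae_le_eLpNormEssSup (f := dyadicBlock φ j f)
    (μ := (volume : Measure (Space d)))] with x hx
  have h2 : ENNReal.ofReal ((2 : ℝ) ^ (-j)) * ‖dyadicBlock φ j f x‖ₑ ≤ ENNReal.ofReal ε :=
    le_trans (by gcongr) hj
  rw [← ofReal_norm, ← ENNReal.ofReal_mul (by positivity), ENNReal.ofReal_le_ofReal_iff hε,
    zpow_neg, inv_mul_le_iff₀ (by positivity)] at h2
  exact h2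

lemma ae_norm_conv_sub_conv_le {φ : Space d → ℝ} {K : 𝓢(Space d, ℝ)}
    (hK : ∀ j x, dyadicKernel φ j x = dyadicDil K j x - dyadicDil K (j - 1) x)
    {f : LInfty d} {ε : ℝ} (hε : 0 ≤ ε) (h : besovNorm φ f ≤ ENNReal.ofReal ε) (N : ℤ) :
    ∀ᵐ x, ∀ n : ℕ, ‖conv (toLOne (dyadicDil K N)) f x
      - conv (toLOne (dyadicDil K (N - n))) f x‖ ≤ (2 : ℝ) ^ (N + 1) * ε := by
  filter_upwards [ae_norm_dyadicBlock_le hε h] with x hx n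
  -- The exact partial sum of the geometric series is carried along so that the induction closes;
  -- the bound obtained from it no longer depends on `n`.
  suffices h : ‖conv (toLOne (dyadicDil K N)) f x - conv (toLOne (dyadicDil K (N - n))) f x‖
      ≤ ((2 : ℝ) ^ (N + 1) - 2 ^ (N + 1 - n)) * ε by
    refine h.trans ?_
    have : (0 : ℝ) < 2 ^ (N + 1 - n) := by positivity
    gcongr
    linarith
  induction n with
  | zero => simp
  | succ n ih =>
    have hb := hx (N - n)
    rw [dyadicBlock_eq hK] at hb
    have e1 : N - ((n + 1 : ℕ) : ℤ) = N - n - 1 := by push_cast; ring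
    have e2 : N + 1 - ((n + 1 : ℕ) : ℤ) = N - n := by push_cast; ring
    have e3 : (2 : ℝ) ^ (N + 1 - (n : ℤ)) = 2 * 2 ^ (N - (n : ℤ)) := by
      rw [show N + 1 - (n : ℤ) = 1 + (N - n) by ring, zpow_add₀ two_ne_zero, zpow_one]
    rw [e1, e2]
    rw [e3] at ih
    have := norm_add_le_of_le ih hb
    rw [sub_add_sub_cancel] at this
    linarith

/-! ### The a priori bound -/

lemma mem_timeInterval_of_le {T : ℝ≥0∞} {s t : ℝ} (ht : t ∈ timeInterval T) (hs : 0 < s)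
    (hst : s ≤ t) : s ∈ timeInterval T :=
  ⟨hs, (ENNReal.ofReal_le_ofReal hst).trans_lt ht.2⟩

namespace IsStrongSolution

variable {u₀ : LInfty d} {T : ℝ≥0∞} {u : ℝ → LInfty d}

lemma continuousOn_Ioo (hu : IsStrongSolution u₀ T u) {t : ℝ} (ht : t ∈ timeInterval T) :
    ContinuousOn u (Ioo 0 t) :=
  hu.continuousOn.mono fun _ hs => mem_timeInterval_of_le ht hs.1 hs.2.le

lemma ae_eq (hu : IsStrongSolution u₀ T u) {t : ℝ} (ht : t ∈ timeInterval T) :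
    u t =ᵐ[volume] (conv (toLOne (heatKernel t)) u₀ - NavierStokes.duhamel u t : Space d →ᵇ Space d) := by
  obtain ⟨A, -, hA⟩ := exists_kernelBound_heatKernel d
  obtain ⟨M, hM⟩ := hu.bounded t ht
  filter_upwards [hu.duhamel t ht] with x hx
  rw [hx, BoundedContinuousFunction.coe_sub, Pi.sub_apply,
    conv_toLOne_apply (hA t ht.1).choose_spec.integrable,
    duhamel_apply ht.1.le (hu.continuousOn_Ioo ht) fun s hs => hM s ⟨hs.1, hs.2.le⟩]
  rfl

lemma eq_toLInfty (hu : IsStrongSolution u₀ T u) {t : ℝ} (ht : t ∈ timeInterval T) :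
    u t = toLInfty (conv (toLOne (heatKernel t)) u₀ - NavierStokes.duhamel u t) :=
  Lp.ext ((hu.ae_eq ht).trans (coeFn_toLInfty _).symm)

end IsStrongSolution

/-- A strong solution with small Besov norm is bounded in terms of its initial data. -/
theorem IsLittlewoodPaley.exists_apriori_bound {φ : Space d → ℝ} (hφ : IsLittlewoodPaley φ) :
    ∃ ε C : ℝ, 0 < ε ∧ ∀ (u₀ : LInfty d) (T : ℝ≥0∞) (u : ℝ → LInfty d),
      IsStrongSolution u₀ T u →
      (∀ t ∈ timeInterval T, besovNorm φ (u t) ≤ ENNReal.ofReal ε) →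
      ∀ t ∈ timeInterval T, ‖u t‖ ≤ C * ‖u₀‖ := by
  obtain ⟨K, hK1, hKeven, hK⟩ := hφ.exists_kernel
  obtain ⟨A, hA0, hA⟩ := exists_kernelBound_heatKernel d
  obtain ⟨C, hC0, hC⟩ := exists_norm_secDiffAt_duhamel_le d
  set m := ∫ x, ‖K x‖ with hm
  set m₁ := ∫ x, ‖K x‖ * ‖x‖ with hm₁
  have hm0 : 0 ≤ m := integral_nonneg fun _ => norm_nonneg _
  have hm₁0 : 0 ≤ m₁ := integral_nonneg fun _ => by positivity
  -- The summand 1 keeps the constant strictly positive, since it appears in a denominator.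
  set c := C * m₁ + 1 with hc
  have hc0 : 0 < c := by positivity
  have hKi := fun j : ℤ => integrable_dyadicDil K.integrable j
  -- With `2^N ≤ 8cM` the value `1/(64c)` makes `2^{N+1} ε` at most `M/4`. In the other constant, `1
  -- + 2m` counts the heat flow and two filtered copies of it, and the factor 2 comes from absorbing
  -- `M/2`.
  refine ⟨1 / (64 * c), 2 * ((1 + 2 * m) * A), by positivity, fun u₀ T u hu hB => ?_⟩
  -- the bound in terms of a bound for earlier times
  have key : ∀ t ∈ timeInterval T, ∀ M, (∀ s ∈ Ioc 0 t, ‖u s‖ ≤ M) → ∀ N : ℤ,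
      ‖u t‖ ≤ (1 + 2 * m) * A * ‖u₀‖ + (2 : ℝ) ^ (N + 1) * (1 / (64 * c))
        + c * M ^ 2 * (2 : ℝ) ^ (-N) := by
    intro t ht M hM N
    have hM' : ∀ s ∈ Ioo 0 t, ‖u s‖ ≤ M := fun s hs => hM s ⟨hs.1, hs.2.le⟩
    have hcont := hu.continuousOn_Ioo ht
    set H := conv (toLOne (heatKernel t)) u₀ with hH
    set W := duhamel u t with hW
    have hHn : ‖H‖ ≤ A * ‖u₀‖ := by
      refine (norm_conv_le _ _).trans ?_
      gcongr
      exact (hA t ht.1).choose_spec.norm_toLOne_le hA0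
    have hSH : ∀ j : ℤ, ‖convOp (dyadicDil K j) H‖ ≤ m * (A * ‖u₀‖) := fun j => by
      refine (norm_convOp_le (hKi j) _).trans ?_
      rw [integral_norm_dyadicDil]
      gcongr
    have hut := hu.eq_toLInfty ht
    have hconv : ∀ (j : ℤ) (x : Space d), conv (toLOne (dyadicDil K j)) (u t) x
        = convOp (dyadicDil K j) H x - convOp (dyadicDil K j) W x := fun j x => by
      rw [hut, ← convOp_apply, map_sub]; rfl
    -- The lower cut-off `N - n` is sent to `-∞` at the price of an arbitrarily small `η`; this is
    -- possible since the block sum is bounded uniformly in `n`.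
    refine le_of_forall_pos_le_add fun η hη => ?_
    obtain ⟨n, hn⟩ : ∃ n : ℕ, ‖convOp (dyadicDil K (N - n)) W‖ < η := by
      have h1 := (tendsto_convOp_duhamel K hcont hM').norm
      rw [norm_zero] at h1
      have h2 : Tendsto (fun n : ℕ => N - (n : ℤ)) atTop atBot :=
        tendsto_const_nhds.add_atBot (tendsto_neg_atTop_atBot.comp tendsto_natCast_atTop_atTop)
      exact ((h1.comp h2).eventually (gt_mem_nhds hη)).exists
    refine norm_LInfty_le (by positivity) ?_
    filter_upwards [hu.ae_eq ht, ae_norm_conv_sub_conv_le hK (by positivity) (hB t ht) N]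
      with x hx hx2
    have b1 := hx2 n
    have b2 : ‖convOp (dyadicDil K (N - n)) H x‖ ≤ m * (A * ‖u₀‖) :=
      (BoundedContinuousFunction.norm_coe_le_norm _ x).trans (hSH _)
    have b3 : ‖convOp (dyadicDil K (N - n)) W x‖ ≤ η :=
      (BoundedContinuousFunction.norm_coe_le_norm _ x).trans hn.le
    have b4 : ‖convOp (dyadicDil K N) H x‖ ≤ m * (A * ‖u₀‖) :=
      (BoundedContinuousFunction.norm_coe_le_norm _ x).trans (hSH _)
    have b5 : ‖H x‖ ≤ A * ‖u₀‖ := (BoundedContinuousFunction.norm_coe_le_norm _ x).trans hHn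
    have b6 := norm_sub_convOp_dyadicDil_le hK1 hKeven (fun h x => hC u t M hcont hM' h x) N x
    have b7 : C * M ^ 2 * ((2 : ℝ) ^ (-N) * m₁) ≤ c * M ^ 2 * (2 : ℝ) ^ (-N) := by
      have : 0 ≤ M ^ 2 * (2 : ℝ) ^ (-N) := by positivity
      rw [hc]
      nlinarith
    -- In short, `u = (S_N u - S_{N-n} u) + S_{N-n} u + (u - S_N u)`, where `u = H - W` is inserted
    -- in the last two terms only; the first is controlled by the Besov norm.
    have e : u t x = (conv (toLOne (dyadicDil K N)) (u t) x
          - conv (toLOne (dyadicDil K (N - n))) (u t) x)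
        + (convOp (dyadicDil K (N - n)) H x - convOp (dyadicDil K (N - n)) W x)
        + (H x - convOp (dyadicDil K N) H x) - (W x - convOp (dyadicDil K N) W x) := by
      rw [hx, hconv, hconv, BoundedContinuousFunction.coe_sub, Pi.sub_apply]
      abel
    rw [e]
    refine (norm_sub_le _ _).trans ?_
    have t1 := norm_add₃_le (a := conv (toLOne (dyadicDil K N)) (u t) x
          - conv (toLOne (dyadicDil K (N - n))) (u t) x)
      (b := convOp (dyadicDil K (N - n)) H x - convOp (dyadicDil K (N - n)) W x)
      (c := H x - convOp (dyadicDil K N) H x)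
    have t2 := norm_sub_le (convOp (dyadicDil K (N - n)) H x) (convOp (dyadicDil K (N - n)) W x)
    have t3 := norm_sub_le (H x) (convOp (dyadicDil K N) H x)
    linarith
  intro S hS
  obtain ⟨M', hM'⟩ := hu.bounded S hS
  -- This supremum is finite by the definition of a strong solution, which is what allows half of it
  -- to be absorbed below.
  set M := sSup ((fun s => ‖u s‖) '' Ioc 0 S) with hMdef
  have hbdd : BddAbove ((fun s => ‖u s‖) '' Ioc 0 S) := ⟨M', by rintro _ ⟨s, hs, rfl⟩; exact hM' s hs⟩
  have hMb : ∀ s ∈ Ioc 0 S, ‖u s‖ ≤ M := fun s hs => le_csSup hbdd ⟨s, hs, rfl⟩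
  have hSS : S ∈ Ioc 0 S := ⟨hS.1, le_rfl⟩
  have hM0 : 0 ≤ M := (norm_nonneg _).trans (hMb S hSS)
  rcases hM0.eq_or_lt with hM0 | hM0
  · refine (hMb S hSS).trans ?_
    rw [← hM0]
    positivity
  -- The cut-off satisfies `4cM < 2^N ≤ 8cM`: the upper bound controls the block sum, the lower one
  -- the high frequencies of the Duhamel term. A power of two is available only for `M > 0`, hence
  -- the preceding case distinction.
  obtain ⟨N, hN1, hN2⟩ := exists_mem_Ico_zpow (show 0 < 8 * c * M by positivity) one_lt_two
  have hhalf : M ≤ (1 + 2 * m) * A * ‖u₀‖ + M / 2 := by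
    refine csSup_le ⟨_, S, hSS, rfl⟩ ?_
    rintro _ ⟨s, hs, rfl⟩
    refine (key s (mem_timeInterval_of_le hS hs.1 hs.2) M
      (fun r hr => hMb r ⟨hr.1, hr.2.trans hs.2⟩) N).trans ?_
    rw [zpow_add₀ two_ne_zero, zpow_one] at hN2 ⊢
    have hp : (0 : ℝ) < 2 ^ N := by positivity
    have a1 : (2 : ℝ) ^ N * 2 * (1 / (64 * c)) ≤ M / 4 := by
      rw [mul_one_div, div_le_iff₀ (by positivity)]
      linarith
    have a2 : c * M ^ 2 * (2 : ℝ) ^ (-N) ≤ M / 4 := by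
      rw [zpow_neg, ← div_eq_mul_inv, div_le_iff₀ hp]
      nlinarith
    linarith
  have := hMb S hSS
  linarith

/-! ### Continuation of bounded solutions -/

lemma timeInterval_ofReal (T : ℝ) : timeInterval (ENNReal.ofReal T) = Ioo 0 T := by
  ext t
  constructor
  · rintro ⟨h1, h2⟩
    exact ⟨h1, (ENNReal.ofReal_lt_ofReal_iff_of_nonneg h1.le).1 h2⟩
  · rintro ⟨h1, h2⟩
    exact ⟨h1, (ENNReal.ofReal_lt_ofReal_iff_of_nonneg h1.le).2 h2⟩

/-- The right-hand side of the Duhamel formula, as a map of `u`. -/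
def duhamelMap (u₀ : LInfty d) (u : ℝ → LInfty d) (t : ℝ) : LInfty d :=
  toLInfty (conv (toLOne (heatKernel t)) u₀ - duhamel u t)

lemma isStrongSolution_of_eq {u₀ : LInfty d} {T M : ℝ} {u : ℝ → LInfty d}
    (hu : ContinuousOn u (Ioo 0 T)) (hM : ∀ t ∈ Ioo 0 T, ‖u t‖ ≤ M)
    (h : ∀ t ∈ Ioo 0 T, u t = duhamelMap u₀ u t) :
    IsStrongSolution u₀ (ENNReal.ofReal T) u := by
  obtain ⟨A, -, hA⟩ := exists_kernelBound_heatKernel d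
  constructor
  · rwa [timeInterval_ofReal]
  · intro S hS
    rw [timeInterval_ofReal] at hS
    exact ⟨M, fun t ht => hM t ⟨ht.1, ht.2.trans_lt hS.2⟩⟩
  · intro t ht
    rw [timeInterval_ofReal] at ht
    have hsub : Ioo 0 t ⊆ Ioo 0 T := Ioo_subset_Ioo_right ht.2.le
    have h1 := coeFn_toLInfty (conv (toLOne (heatKernel t)) u₀ - duhamel u t)
    filter_upwards [h1] with x hx
    rw [h t ht, duhamelMap, hx, BoundedContinuousFunction.coe_sub, Pi.sub_apply,
      conv_toLOne_apply (hA t ht.1).choose_spec.integrable,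
      duhamel_apply ht.1.le (hu.mono hsub) fun s hs => hM s (hsub hs)]
    rfl

lemma continuousOn_duhamelMap (u₀ : LInfty d) {u : ℝ → LInfty d} {T M : ℝ}
    (hu : ContinuousOn u (Ioo 0 T)) (hM : ∀ s ∈ Ioo 0 T, ‖u s‖ ≤ M) :
    ContinuousOn (duhamelMap u₀ u) (Ioo 0 T) := by
  have h1 : ContinuousOn (fun t => conv (toLOne (heatKernel t)) u₀) (Ioo 0 T) :=
    (conv.continuous.comp_continuousOn
      (continuousOn_toLOne_heatKernel.mono Ioo_subset_Ioi_self)).clm_apply continuousOn_const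
  exact toLInfty.continuous.comp_continuousOn (h1.sub (continuousOn_duhamel hu hM))

/-- Bounded solutions can be continued by a time that depends only on the bounds. -/
lemma exists_continuation (d : ℕ) (u₀ : LInfty d) (M T : ℝ) :
    ∃ δ : ℝ, 0 < δ ∧ ∀ (t₁ : ℝ) (u : ℝ → LInfty d), 0 ≤ t₁ → t₁ ≤ T →
      ContinuousOn u (Ioc 0 t₁) → (∀ t, 0 ≤ t → t ≤ t₁ → ‖u t‖ ≤ M) →
      (∀ t ∈ Ioc 0 t₁, u t = duhamelMap u₀ u t) →
      ∃ v, IsStrongSolution u₀ (ENNReal.ofReal (t₁ + δ)) v := by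
  obtain ⟨A, hA0, hA⟩ := exists_kernelBound_heatKernel d
  obtain ⟨C, hC0, hC⟩ := exists_norm_duhamel_le d
  obtain ⟨C', hC'0, hC'⟩ := exists_norm_duhamel_sub_le d
  -- The radius covers the heat flow and the Duhamel term of the path `u` frozen after `t₁`, for any
  -- `t₁ ≤ T` and `δ ≤ 1`; the final 1 leaves room for the perturbation.
  set R := |M| + A * ‖u₀‖ + C * M ^ 2 * √(|T| + 1) + 1 with hR
  have hR1 : 1 ≤ R := by
    have : 0 ≤ |M| + A * ‖u₀‖ + C * M ^ 2 * √(|T| + 1) := by positivity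
    linarith
  -- One condition gives both requirements: `2R` bounds the distance between two admissible paths,
  -- so the ball is preserved, and `R ≥ 1` yields contraction with factor `1/2`. It is imposed
  -- before `t₁` is known.
  obtain ⟨δ, hδ0, hδ1, hδ⟩ : ∃ δ : ℝ, 0 < δ ∧ δ ≤ 1 ∧ C' * R * (2 * R) * √δ ≤ 1 / 2 := by
    have hlim : Tendsto (fun δ : ℝ => C' * R * (2 * R) * √δ) (𝓝[>] 0) (𝓝 0) := by
      have : Continuous fun δ : ℝ => C' * R * (2 * R) * √δ := by fun_prop
      have := (this.tendsto 0).mono_left (nhdsWithin_le_nhds (s := Ioi 0))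
      simpa using this
    have h1 := hlim.eventually (ge_mem_nhds (show (0 : ℝ) < 1 / 2 by norm_num))
    have h2 : ∀ᶠ δ in 𝓝[>] (0 : ℝ), δ ≤ 1 := nhdsWithin_le_nhds (ge_mem_nhds one_pos)
    obtain ⟨δ, hδ⟩ := ((h1.and h2).and self_mem_nhdsWithin).exists
    exact ⟨δ, hδ.2, hδ.1.2, hδ.1.1⟩
  refine ⟨δ, hδ0, fun t₁ u ht₁ ht₁T hu hM hfix => ?_⟩
  set T' := t₁ + δ with hT'
  have hT'0 : 0 < T' := by positivity
  let X := (Ioo 0 T') →ᵇ LInfty d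
  -- extension of an element of `X` by zero
  let ext : X → ℝ → LInfty d := fun v t => if h : t ∈ Ioo 0 T' then v ⟨t, h⟩ else 0
  have ext_eq : ∀ (v : X) (t : ℝ) (h : t ∈ Ioo 0 T'), ext v t = v ⟨t, h⟩ := fun v t h => dif_pos h
  have ext_cont : ∀ v : X, ContinuousOn (ext v) (Ioo 0 T') := fun v => by
    rw [continuousOn_iff_continuous_domRestrict]
    refine v.continuous.congr fun t => ?_
    rw [domRestrict_apply, ext_eq v t t.2]
  have ext_le : ∀ (v : X) (t : ℝ), t ∈ Ioo 0 T' → ‖ext v t‖ ≤ ‖v‖ := fun v t h => by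
    rw [ext_eq v t h]; exact v.norm_coe_le_norm _
  -- the reference function
  have hmin : ∀ t ∈ Ioo 0 T', 0 ≤ min t t₁ ∧ min t t₁ ≤ t₁ := fun t ht =>
    ⟨le_min ht.1.le ht₁, min_le_right _ _⟩
  have hMb : ∀ t ∈ Ioo 0 T', ‖u (min t t₁)‖ ≤ M := fun t ht => hM _ (hmin t ht).1 (hmin t ht).2
  have hw_cont : ContinuousOn (fun t => u (min t t₁)) (Ioo 0 T') := by
    -- For `t₁ = 0` the frozen path is the constant `u 0`. This is why the norm bound is also
    -- required at time zero, although that value plays no role in the equation.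
    rcases ht₁.eq_or_lt with h0 | h0
    · refine (continuousOn_const (c := u 0)).congr fun t ht => ?_
      rw [← h0, min_eq_right ht.1.le]
    · exact hu.comp (by fun_prop) fun t ht => ⟨lt_min ht.1 h0, min_le_right _ _⟩
  let w : X := BoundedContinuousFunction.ofNormedAddCommGroup
    ((Ioo 0 T').domRestrict fun t => u (min t t₁)) (continuousOn_iff_continuous_domRestrict.1 hw_cont) M
    fun t => hMb t t.2
  have w_eq : ∀ t (h : t ∈ Ioo 0 T'), w ⟨t, h⟩ = u (min t t₁) := fun t h => rfl
  have ext_w : ∀ t ∈ Ioo 0 T', ext w t = u (min t t₁) := fun t h => ext_eq w t h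
  have hMle : M ≤ R := by
    have h1 := le_abs_self M
    have : 0 ≤ A * ‖u₀‖ + C * M ^ 2 * √(|T| + 1) := by positivity
    linarith
  have w_norm : ‖w‖ ≤ R := by
    rw [BoundedContinuousFunction.norm_le (by linarith)]
    exact fun t => (hMb t t.2).trans hMle
  -- the fixed point map
  let Ψ : X → X := fun v => BoundedContinuousFunction.ofNormedAddCommGroup
    ((Ioo 0 T').domRestrict (duhamelMap u₀ (ext v)))
    (continuousOn_iff_continuous_domRestrict.1
      (continuousOn_duhamelMap u₀ (ext_cont v) (ext_le v)))
    (A * ‖u₀‖ + C * ‖v‖ ^ 2 * √T') fun t => by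
      refine (norm_toLInfty_le _).trans ((norm_sub_le _ _).trans (add_le_add ?_ ?_))
      · refine (norm_conv_le _ _).trans ?_
        gcongr
        exact (hA t t.2.1).choose_spec.norm_toLOne_le hA0
      · refine (hC (ext v) t ‖v‖ fun s hs => ext_le v s ⟨hs.1, hs.2.trans t.2.2⟩).trans ?_
        gcongr
        exact t.2.2.le
  have Ψ_eq : ∀ v (t : ℝ) (h : t ∈ Ioo 0 T'), Ψ v ⟨t, h⟩ = duhamelMap u₀ (ext v) t :=
    fun v t h => rfl
  -- Prescribing the past confines differences of paths to the last `δ` units of time, while a fixed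
  -- point still solves the Duhamel equation from time zero.
  let S : Set X := {v | ‖v‖ ≤ R ∧ ∀ t (h : t ∈ Ioo 0 T'), t ≤ t₁ → v ⟨t, h⟩ = u t}
  have hS_closed : IsClosed S := by
    have e : S = {v | ‖v‖ ≤ R} ∩ ⋂ (t : ℝ) (h : t ∈ Ioo 0 T') (_ : t ≤ t₁), {v | v ⟨t, h⟩ = u t} := by
      ext v
      simp only [S, mem_inter_iff, mem_iInter]
      rfl
    rw [e]
    refine (isClosed_le continuous_norm continuous_const).inter ?_
    refine isClosed_iInter fun t => isClosed_iInter fun h => isClosed_iInter fun _ => ?_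
    exact isClosed_eq (BoundedContinuousFunction.evalCLM ℝ (⟨t, h⟩ : Ioo 0 T')).continuous
      continuous_const
  have hwS : w ∈ S := ⟨w_norm, fun t h ht => by rw [w_eq, min_eq_left ht]⟩
  -- the difference estimate
  have hdiff : ∀ v ∈ S, ∀ v' ∈ S, ∀ t ∈ Ioo 0 T',
      ‖duhamel (ext v) t - duhamel (ext v') t‖ ≤ C' * R * ‖v - v'‖ * √δ := by
    intro v hv v' hv' t ht
    have hs : ∀ s ∈ Ioo 0 t, s ∈ Ioo 0 T' := fun s hs => ⟨hs.1, hs.2.trans ht.2⟩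
    have := hC' (ext v) (ext v') t₁ δ R ‖v - v'‖ t hδ0.le ht.2.le (norm_nonneg _)
      ((ext_cont v).mono hs) ((ext_cont v').mono hs)
      (fun s h => (ext_le v s (hs s h)).trans hv.1) (fun s h => (ext_le v' s (hs s h)).trans hv'.1)
      (fun s h hst => by
        rw [ext_eq v s (hs s h), ext_eq v' s (hs s h), hv.2 s (hs s h) hst, hv'.2 s (hs s h) hst])
      (fun s h => by
        rw [ext_eq v s (hs s h), ext_eq v' s (hs s h)]
        exact (v - v').norm_coe_le_norm ⟨s, hs s h⟩)
    rwa [abs_of_nonneg (by linarith)] at this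
  have hmaps : MapsTo Ψ S S := by
    intro v hv
    refine ⟨?_, fun t h ht => ?_⟩
    · rw [BoundedContinuousFunction.norm_le (by linarith)]
      rintro ⟨t, ht⟩
      have h1 : ‖duhamel (ext w) t‖ ≤ C * M ^ 2 * √(|T| + 1) := by
        refine (hC (ext w) t M fun s hs => ?_).trans ?_
        · have hs' : s ∈ Ioo 0 T' := ⟨hs.1, hs.2.trans ht.2⟩
          rw [ext_w s hs']
          exact hMb s hs'
        · gcongr
          have := le_abs_self T
          linarith [ht.2]
      have h2 := hdiff v hv w hwS t ht
      have h3 : ‖v - w‖ ≤ 2 * R := (norm_sub_le _ _).trans (by linarith [hv.1])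
      have h4 : C' * R * ‖v - w‖ * √δ ≤ C' * R * (2 * R) * √δ := by gcongr
      have h5 : ‖conv (toLOne (heatKernel t)) u₀‖ ≤ A * ‖u₀‖ := by
        refine (norm_conv_le _ _).trans ?_
        gcongr
        exact (hA t ht.1).choose_spec.norm_toLOne_le hA0
      have h6 : ‖duhamel (ext v) t‖ ≤ ‖duhamel (ext v) t - duhamel (ext w) t‖
          + ‖duhamel (ext w) t‖ := norm_le_norm_sub_add _ _
      rw [Ψ_eq, duhamelMap]
      refine (norm_toLInfty_le _).trans ((norm_sub_le _ _).trans ?_)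
      linarith [abs_nonneg M]
    · have ht0 : t ∈ Ioc 0 t₁ := ⟨h.1, ht⟩
      rw [Ψ_eq, hfix t ht0, duhamelMap, duhamelMap]
      congr 2
      refine setIntegral_congr_ae measurableSet_Ioc ?_
      filter_upwards [Measure.ae_ne volume t] with r hrt hr
      have hs : t - r ∈ Ioo 0 T' :=
        ⟨sub_pos.2 (lt_of_le_of_ne hr.2 hrt), (sub_lt_self _ hr.1).trans h.2⟩
      rw [ext_eq v _ hs, hv.2 _ hs (by linarith [hr.1])]
  have hcontr : ContractingWith (1 / 2) (hmaps.restrict Ψ S S) := by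
    refine ⟨by norm_num, LipschitzWith.of_dist_le_mul fun v v' => ?_⟩
    rw [Subtype.dist_eq, Subtype.dist_eq, dist_eq_norm, dist_eq_norm, MapsTo.val_restrict_apply,
      MapsTo.val_restrict_apply, BoundedContinuousFunction.norm_le (by positivity)]
    rintro ⟨t, ht⟩
    have h1 := hdiff v v.2 v' v'.2 t ht
    have e : (Ψ v - Ψ v') ⟨t, ht⟩ = toLInfty (duhamel (ext v') t - duhamel (ext v) t) := by
      rw [BoundedContinuousFunction.coe_sub, Pi.sub_apply, Ψ_eq, Ψ_eq, duhamelMap, duhamelMap,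
        ← map_sub]
      congr 1
      abel
    rw [e]
    refine (norm_toLInfty_le _).trans ?_
    rw [norm_sub_rev]
    refine h1.trans ?_
    have hR2 : C' * R * √δ ≤ 1 / 2 := by
      have : 0 ≤ C' * R * √δ := by positivity
      nlinarith
    calc C' * R * ‖(v : X) - v'‖ * √δ = (C' * R * √δ) * ‖(v : X) - v'‖ := by ring
      _ ≤ 1 / 2 * ‖(v : X) - v'‖ := by gcongr
      _ = _ := by push_cast; rfl
  obtain ⟨v, hvS, hv, -⟩ := hcontr.exists_fixedPoint' hS_closed.isComplete hmaps hwS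
    (edist_ne_top _ _)
  refine ⟨ext v, isStrongSolution_of_eq (ext_cont v) (ext_le v) fun t ht => ?_⟩
  rw [← Ψ_eq v t ht, hv, ext_eq v t ht]

/-- A strong solution that is bounded up to a finite time is not maximal. -/
lemma not_bounded_of_maximalTime_ne_top {u₀ : LInfty d} {u : ℝ → LInfty d} {M : ℝ}
    (hT : maximalTime u₀ ≠ ⊤) (hu : IsStrongSolution u₀ (maximalTime u₀) u)
    (hM : ∀ t ∈ timeInterval (maximalTime u₀), ‖u t‖ ≤ M) : False := by
  set T := (maximalTime u₀).toReal with hTdef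
  have hTeq : maximalTime u₀ = ENNReal.ofReal T := (ENNReal.ofReal_toReal hT).symm
  have hT0 : 0 ≤ T := ENNReal.toReal_nonneg
  rw [hTeq, timeInterval_ofReal] at hM
  -- As `δ` is uniform in the continuation time, continuing from `T - δ/2` reaches beyond `T`.
  -- Truncation at zero covers `T < δ/2`, including `T = 0`, where the continuation result reduces
  -- to local existence.
  obtain ⟨δ, hδ, h⟩ := exists_continuation d u₀ (max M ‖u 0‖) T
  have ht₁T : ∀ t, 0 < t → t ≤ max (T - δ / 2) 0 → t ∈ Ioo 0 T := fun t h0 ht =>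
    ⟨h0, by
      rcases le_max_iff.1 ht with h' | h'
      · linarith
      · linarith⟩
  obtain ⟨v, hv⟩ := h (max (T - δ / 2) 0) u (le_max_right _ _) (max_le (by linarith) hT0)
    (hu.continuousOn.mono fun t ht => by
      rw [hTeq, timeInterval_ofReal]; exact ht₁T t ht.1 ht.2)
    (fun t h0 ht => by
      rcases h0.eq_or_lt with rfl | h0
      · exact le_max_right _ _
      · exact (hM t (ht₁T t h0 ht)).trans (le_max_left _ _))
    (fun t ht => hu.eq_toLInfty (by
      rw [hTeq, timeInterval_ofReal]; exact ht₁T t ht.1 ht.2))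
  have h1 : ENNReal.ofReal (max (T - δ / 2) 0 + δ) ≤ maximalTime u₀ := le_sSup ⟨v, hv⟩
  rw [hTeq, ENNReal.ofReal_le_ofReal_iff hT0] at h1
  have := le_max_left (T - δ / 2) 0
  linarith

end NavierStokes

end

/-! ### Global existence under a small critical Besov norm -/

open NavierStokes in
theorem proposition3p6 (d : ℕ) (hd : 3 ≤ d) (φ : Space d → ℝ) (hφ : IsLittlewoodPaley φ) :
    ∃ ε : ℝ, 0 < ε ∧
      ∀ (u₀ : LInfty d) (u : ℝ → LInfty d),
        IsDivFree u₀ →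
        IsStrongSolution u₀ (maximalTime u₀) u →
        (⨆ t ∈ timeInterval (maximalTime u₀), besovNorm φ (u t)) < ENNReal.ofReal ε →
        maximalTime u₀ = ⊤ := by
  obtain ⟨ε, C, hε, h⟩ := hφ.exists_apriori_bound
  refine ⟨ε, hε, fun u₀ u _ hu hB => ?_⟩
  by_contra hT
  refine not_bounded_of_maximalTime_ne_top hT hu (M := C * ‖u₀‖) ?_
  exact h u₀ _ u hu fun t ht => (le_iSup₂ (f := fun t _ => besovNorm φ (u t)) t ht).trans hB.le
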